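/- **Uniform cosine and sine laws for generalized hyperbolic triangles.** *Generalized triangles.* Let $v_1,v_2,v_3$ be the vertices of a non-degenerate triangle $\widetilde\triangle$ in the projective plane containing the Klein model of $\mathbb H^2$, let $L_i$ be the geodesic of $\mathbb H^2$ on the side line opposite to $v_i$, and attach a horodisc to each ideal vertex. The type of $v_i$ is $\varepsilon_i=1,0,-1$ according as $v_i\in\mathbb H^2$, $v_i\in\partial\mathbb H^2$, or $v_i\notin\mathbb H^2\cup\partial\mathbb H^2$. Let $\triangle\subset\mathbb H^2$ be the polygon obtained from $\widetilde\triangle\cap\mathbb H^2$ by cutting off each vertex of type $-1$ along its polar geodesic, that is, the common perpendicular of the two sides through it. The data form a *generalized hyperbolic triangle* of type $(\varepsilon_1,\varepsilon_2,\varepsilon_3)\in\{-1,0,1\}^3$ if every $L_i\cap\triangle$ is a genuine edge (has more than one point). *Angles.* The generalized angle $\theta_i$ at $v_i$ is the inner angle if $\varepsilon_i=1$; twice the length of the part of the horocycle at $v_i$ lying in the cusp bounded by the two sides through $v_i$ if $\varepsilon_i=0$; and the distance of the two sides through $v_i$ if $\varepsilon_i=-1$. *Lengths.* Let $B_u$ be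 $\{u\}$, the horodisc at $u$, or the half plane missing $\triangle$ bounded by the polar geodesic of $u$, for a vertex $u$ of type $1,0,-1$ respectively (for type $-1$, $B_u$ contains its bounding geodesic, so it meets $\triangle$ only along that geodesic). If $u,w$ are the two vertices on $L_i$, the generalized length $l_i$ of the edge opposite to $v_i$ is the distance from $B_u$ to $B_w$ if $B_u\cap B_w=\emptyset$, and minus the distance from $\partial B_u\cap L_i$ to $\partial B_w\cap L_i$ otherwise. *Functions.* For $\varepsilon,s\in\{-1,0,1\}$ put $$\rho_\varepsilon(\theta)=\int_0^\theta\cos(\sqrt\varepsilon\,x)\,dx,\qquad \tau_s(l)=\tfrac12e^{l}-\tfrac12s\,e^{-l},$$ so $\rho_1=\sin$, $\rho_0(\theta)=\theta$, $\rho_{-1}=\sinh$, and let $\rho'_\varepsilon,\tau'_s$ be the derivatives in $\theta$ and in $l$. *Claim.* For every generalized hyperbolic triangle of any type $(\varepsilon_1,\varepsilon_2,\varepsilon_3)\in\{-1,0,1\}^3$, with generalized angles $\theta_1,\theta_2,\theta_3$ and opposite generalized edge lengths $l_1,l_2,l_3$, and for all $\{i,j,k\}=\{1,2,3\}$, the numbers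 $\rho_{\varepsilon_i}(\theta_i)$ and $\tau_{\varepsilon_j\varepsilon_k}(l_i)$ are non-zero and $$\tau'_{\varepsilon_j\varepsilon_k}(l_i)=\frac{\rho'_{\varepsilon_i}(\theta_i)+\rho'_{\varepsilon_j}(\theta_j)\rho'_{\varepsilon_k}(\theta_k)}{\rho_{\varepsilon_j}(\theta_j)\rho_{\varepsilon_k}(\theta_k)},$$ $$2\rho_{\varepsilon_i}^2\!\left(\tfrac{\theta_i}2\right)=\frac{\tau'_{\varepsilon_j\varepsilon_k}(l_i)-\frac12\varepsilon_je^{l_j-l_k}-\frac12\varepsilon_ke^{l_k-l_j}}{\tau_{\varepsilon_k\varepsilon_i}(l_j)\,\tau_{\varepsilon_i\varepsilon_j}(l_k)},$$ $$\rho'_{\varepsilon_i}(\theta_i)=\frac{-\varepsilon_i\tau'_{\varepsilon_j\varepsilon_k}(l_i)+\tau'_{\varepsilon_k\varepsilon_i}(l_j)\,\tau'_{\varepsilon_i\varepsilon_j}(l_k)}{\tau_{\varepsilon_k\varepsilon_i}(l_j)\,\tau_{\varepsilon_i\varepsilon_j}(l_k)},$$ $$\frac{\rho_{\varepsilon_i}(\theta_i)}{\tau_{\varepsilon_j\varepsilon_k}(l_i)}=\frac{\rho_{\varepsilon_j}(\theta_j)}{\tau_{\varepsilon_k\varepsilon_i}(l_j)}.$$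 -/

import Mathlib

open scoped Real

noncomputable section

/-! ### The functions `ρ` and `τ` -/

/-- `ρ_ε(θ) = ∫₀^θ cos(√ε x) dx`, the integrand being real for real `ε` (`√(-1)` is `I`). -/
def rho (ε θ : ℝ) : ℝ :=
  ∫ x in (0 : ℝ)..θ, (Complex.cos ((ε : ℂ) ^ (1 / 2 : ℂ) * (x : ℂ))).re

/-- `ρ'_ε(θ) = ∂ρ_ε(θ)/∂θ`. -/
def rho' (ε θ : ℝ) : ℝ := deriv (rho ε) θ

/-- `τ_s(l) = (e^l - s e^{-l})/2`. -/
def tau (s l : ℝ) : ℝ := 1 / 2 * Real.exp l - 1 / 2 * s * Real.exp (-l)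

/-- `τ'_s(l) = ∂τ_s(l)/∂l`. -/
def tau' (s l : ℝ) : ℝ := deriv (tau s) l

theorem rho_one (θ : ℝ) : rho 1 θ = Real.sin θ := by
  have h : ∀ x : ℝ, (Complex.cos (((1 : ℝ) : ℂ) ^ (1 / 2 : ℂ) * (x : ℂ))).re = Real.cos x := by
    intro x
    rw [Complex.ofReal_one, Complex.one_cpow, one_mul, Complex.cos_ofReal_re]
  simp only [rho, h, integral_cos, Real.sin_zero, sub_zero]

theorem rho_zero (θ : ℝ) : rho 0 θ = θ := by
  have h : ∀ x : ℝ, (Complex.cos (((0 : ℝ) : ℂ) ^ (1 / 2 : ℂ) * (x : ℂ))).re = 1 := by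
    intro x
    rw [Complex.ofReal_zero, Complex.zero_cpow (by norm_num), zero_mul, Complex.cos_zero,
      Complex.one_re]
  simp only [rho, h]
  simp

theorem rho_neg_one (θ : ℝ) : rho (-1) θ = Real.sinh θ := by
  have h : ∀ x : ℝ, (Complex.cos (((-1 : ℝ) : ℂ) ^ (1 / 2 : ℂ) * (x : ℂ))).re = Real.cosh x := by
    intro x
    have hI : ((-1 : ℝ) : ℂ) ^ (1 / 2 : ℂ) = Complex.I := by
      rw [Complex.cpow_def_of_ne_zero (by norm_num)]
      have : Complex.log ((-1 : ℝ) : ℂ) * (1 / 2 : ℂ) = (π : ℂ) / 2 * Complex.I := by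
        rw [Complex.ofReal_neg, Complex.ofReal_one, Complex.log_neg_one]; ring
      rw [this, Complex.exp_mul_I, Complex.cos_pi_div_two, Complex.sin_pi_div_two]
      ring
    rw [hI, mul_comm, Complex.cos_mul_I, Complex.cosh_ofReal_re]
  simp only [rho, h]
  rw [intervalIntegral.integral_eq_sub_of_hasDerivAt
    (fun x _ => Real.hasDerivAt_sinh x) (Real.continuous_cosh.intervalIntegrable _ _)]
  simp

theorem rho'_one (θ : ℝ) : rho' 1 θ = Real.cos θ := by
  have : rho 1 = Real.sin := funext rho_one
  rw [rho', this, Real.deriv_sin]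

theorem rho'_zero (θ : ℝ) : rho' 0 θ = 1 := by
  have : rho 0 = fun x => x := funext rho_zero
  rw [rho', this]
  simp

theorem rho'_neg_one (θ : ℝ) : rho' (-1) θ = Real.cosh θ := by
  have : rho (-1) = Real.sinh := funext rho_neg_one
  rw [rho', this, Real.deriv_sinh]

theorem tau'_eq (s l : ℝ) :
    tau' s l = 1 / 2 * Real.exp l + 1 / 2 * s * Real.exp (-l) := by
  have h : HasDerivAt (tau s)
      (1 / 2 * Real.exp l - 1 / 2 * s * (Real.exp (-l) * (-1))) l := by
    unfold tau
    exact ((Real.hasDerivAt_exp l).const_mul _).sub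
      (((hasDerivAt_neg l).exp).const_mul _)
  rw [tau', h.deriv]; ring

/-! ### The hyperbolic plane (hyperboloid model) -/

/-- The vectors of `ℝ^{2,1}`.  The coordinate `0` is the time coordinate; the nonzero vectors,
up to scaling, are the points of the projective plane that contains the Klein model. -/
abbrev Vec : Type := Fin 3 → ℝ

/-- The Lorentz form of `ℝ^{2,1}`. -/
def mink (x y : Vec) : ℝ := -(x 0 * y 0) + x 1 * y 1 + x 2 * y 2

/-- The hyperbolic plane `ℍ²`: the upper sheet of the hyperboloid. -/
def hypPlane : Set Vec := {x | mink x x = -1 ∧ 0 < x 0}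

/-- The hyperbolic distance: `cosh d(x, y) = -⟨x, y⟩`. -/
def hypDist (x y : Vec) : ℝ := Real.arcosh (-mink x y)

/-- The distance between two sets of points of `ℍ²`. -/
def setDist (A B : Set Vec) : ℝ := sInf {d | ∃ x ∈ A, ∃ y ∈ B, d = hypDist x y}

/-- The hyperbolic length of a `C¹` curve `γ : [0, 1] → ℍ²`; the Riemannian metric of `ℍ²` is the
restriction of the Lorentz form. -/
def curveLength (γ : ℝ → Vec) : ℝ :=
  ∫ t in (0 : ℝ)..1, Real.sqrt (mink (deriv γ t) (deriv γ t))

/-- The length of a simple `C¹` arc `A` in `ℍ²`: the length of any injective `C¹` curve that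
traces it out (all of these have the same length, and the infimum picks it). -/
def arcLength (A : Set Vec) : ℝ :=
  sInf {L | ∃ γ : ℝ → Vec, ContDiff ℝ 1 γ ∧ Set.InjOn γ (Set.Icc 0 1) ∧
    γ '' Set.Icc 0 1 = A ∧ L = curveLength γ}

/-- The point of `ℍ²` on the ray spanned by a future timelike vector. -/
def toHyp (v : Vec) : Vec := (Real.sqrt (-mink v v))⁻¹ • v

/-- The component of `x` tangent to `ℍ²` at `p ∈ ℍ²`.  It is the initial direction of the geodesic
that runs from `p` towards the projective point `x` through the points of `ℍ²` of the form
`a • p + b • x` with `a, b ≥ 0`. -/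
def tangentPart (p x : Vec) : Vec := x + mink x p • p

/-- The angle at `p ∈ ℍ²` between the geodesics from `p` towards `x` and towards `y`. -/
def hypAngle (p x y : Vec) : ℝ :=
  Real.arccos (mink (tangentPart p x) (tangentPart p y) /
    (Real.sqrt (mink (tangentPart p x) (tangentPart p x)) *
      Real.sqrt (mink (tangentPart p y) (tangentPart p y))))

/-! ### Generalized hyperbolic triangles -/

/-- The geodesic `L_i` opposite to the vertex `v i`: the trace on `ℍ²` of the projective line
through the other two vertices. -/
def sideLine (v : Fin 3 → Vec) (i : Fin 3) : Set Vec :=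
  {x | x ∈ hypPlane ∧ ∃ a b : ℝ, x = a • v (i + 1) + b • v (i + 2)}

/-- The polygon `Δ`: the part in `ℍ²` of the projective triangle with vertices `v 0, v 1, v 2`,
cut off, at each vertex outside the closed disc of the Klein model, along the polar geodesic of
that vertex (the common perpendicular of the two sides through it). -/
def polygon (v : Fin 3 → Vec) : Set Vec :=
  {x | x ∈ hypPlane ∧
    (∃ a : Fin 3 → ℝ, (∀ i, 0 ≤ a i) ∧ x = ∑ i, a i • v i) ∧
    ∀ i, 0 < mink (v i) (v i) → mink x (v i) ≤ 0}

/-- A generalized hyperbolic triangle, given by its three generalized vertices in homogeneous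
coordinates of the Klein model, and by a horodisc at each ideal vertex.
The vertex `v i` is in `ℍ²`, on the circle at infinity, or outside according as `⟨v i, v i⟩` is
negative, zero or positive. -/
structure GenTriangle where
  /-- The generalized vertices; the projective triangle is the cone on these vectors. -/
  v : Fin 3 → Vec
  /-- The triangle is not degenerate. -/
  indep : LinearIndependent ℝ v
  /-- The vertices in `ℍ²` and those at infinity are represented by future vectors. -/
  future : ∀ i, mink (v i) (v i) ≤ 0 → 0 < v i 0
  /-- The polygon is bounded by `L_0`, `L_1`, `L_2`: each of these geodesics carries a genuine
  edge `L_i ∩ Δ`. -/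
  edge_nontrivial : ∀ i, (sideLine v i ∩ polygon v).Nontrivial
  /-- The level of the horodisc `{x ∈ ℍ² | -⟨x, v i⟩ ≤ horo i}` at an ideal vertex; it is not
  used at the other vertices. -/
  horo : Fin 3 → ℝ
  horo_pos : ∀ i, mink (v i) (v i) = 0 → 0 < horo i

namespace GenTriangle

variable (T : GenTriangle)

/-- The type `ε_i` of a vertex: `1` in `ℍ²`, `0` at infinity, `-1` outside. -/
def type (i : Fin 3) : ℝ :=
  if mink (T.v i) (T.v i) < 0 then 1 else if mink (T.v i) (T.v i) = 0 then 0 else -1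

/-- The set `B_u` of a vertex `u`: the point `u`, the horodisc at `u`, or the half plane missing
`Δ` that is bounded by the polar geodesic of `u`. -/
def body (i : Fin 3) : Set Vec :=
  if mink (T.v i) (T.v i) < 0 then {toHyp (T.v i)}
  else if mink (T.v i) (T.v i) = 0 then {x | x ∈ hypPlane ∧ -mink x (T.v i) ≤ T.horo i}
  else {x | x ∈ hypPlane ∧ 0 ≤ mink x (T.v i)}

/-- The boundary `∂B_u`: the point `u`, the horocycle at `u`, or the polar geodesic of `u`. -/
def bodyBoundary (i : Fin 3) : Set Vec :=
  if mink (T.v i) (T.v i) < 0 then {toHyp (T.v i)}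
  else if mink (T.v i) (T.v i) = 0 then {x | x ∈ hypPlane ∧ -mink x (T.v i) = T.horo i}
  else {x | x ∈ hypPlane ∧ mink x (T.v i) = 0}

/-- The region at the vertex `v i` that is bounded by the two sides through `v i`: the
intersection of the half plane of each of these sides that contains the triangle.  At an ideal
vertex this is the cusp bounded by the two sides. -/
def sector (i : Fin 3) : Set Vec :=
  {x | x ∈ hypPlane ∧ ∃ a b c : ℝ, 0 ≤ b ∧ 0 ≤ c ∧
    x = a • T.v i + b • T.v (i + 1) + c • T.v (i + 2)}

/-- The generalized angle `θ_i` at the vertex `v i`: the inner angle if the vertex is in `ℍ²`,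
twice the length of the part of the horocycle in the cusp if the vertex is ideal, and the
distance of the two sides through the vertex if it is outside. -/
def angle (i : Fin 3) : ℝ :=
  if mink (T.v i) (T.v i) < 0 then hypAngle (toHyp (T.v i)) (T.v (i + 1)) (T.v (i + 2))
  else if mink (T.v i) (T.v i) = 0 then 2 * arcLength (T.bodyBoundary i ∩ T.sector i)
  else setDist (sideLine T.v (i + 1)) (sideLine T.v (i + 2))

open Classical in
/-- The generalized length `l_i` of the edge on `L_i`, which is opposite to the vertex `v i`. -/
def length (i : Fin 3) : ℝ :=
  if T.body (i + 1) ∩ T.body (i + 2) = ∅ then setDist (T.body (i + 1)) (T.body (i + 2))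
  else -setDist (T.bodyBoundary (i + 1) ∩ sideLine T.v i) (T.bodyBoundary (i + 2) ∩ sideLine T.v i)

end GenTriangle

end

/-!
Normalise the vertices to vectors `uᵢ` with `⟨uᵢ, uᵢ⟩ = -εᵢ`, an ideal vertex being scaled so that
its horodisc has level `1/2`, and put `gᵢ = -⟨uⱼ, uₖ⟩`, `mᵢ = √(gᵢ² - εⱼ εₖ)` and
`V = |det (u₁, u₂, u₃)|`.

In null vectors `p, m` with `⟨p, m⟩ = -1/2` the vertices on a side are `m + ε p` and
`e^l p + ε' e^{-l} m`, where `l` is the generalized length of the edge whatever the types are.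
Hence `gᵢ = τ'(lᵢ)` and `mᵢ = τ(lᵢ)`, and `e^{lᵢ} = gᵢ + mᵢ`.

At a vertex in `ℍ²` the angle is read off the tangent vectors, at an ideal one off the horocycle,
which is a flat line on which the Lorentz form measures length, and at one outside off the feet of
the common perpendicular. In all three cases
`ρ'(θᵢ) = (gⱼ gₖ - εᵢ gᵢ) / (mⱼ mₖ)` and `ρ(θᵢ) = V / (mⱼ mₖ)`.
All the laws are then polynomial identities between the entries and minors of the Gram matrix.
-/

noncomputable section

/-! ### The Lorentz form -/

theorem mink_comm (x y : Vec) : mink x y = mink y x := by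
  simp only [mink]; ring

theorem mink_add_left (x y z : Vec) : mink (x + y) z = mink x z + mink y z := by
  simp only [mink, Pi.add_apply]; ring

theorem mink_add_right (x y z : Vec) : mink x (y + z) = mink x y + mink x z := by
  simp only [mink, Pi.add_apply]; ring

theorem mink_sub_left (x y z : Vec) : mink (x - y) z = mink x z - mink y z := by
  simp only [mink, Pi.sub_apply]; ring

theorem mink_sub_right (x y z : Vec) : mink x (y - z) = mink x y - mink x z := by
  simp only [mink, Pi.sub_apply]; ring

theorem mink_smul_left (a : ℝ) (x y : Vec) : mink (a • x) y = a * mink x y := by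
  simp only [mink, Pi.smul_apply, smul_eq_mul]; ring

theorem mink_smul_right (a : ℝ) (x y : Vec) : mink x (a • y) = a * mink x y := by
  simp only [mink, Pi.smul_apply, smul_eq_mul]; ring

theorem mink_self_add (x y : Vec) :
    mink (x + y) (x + y) = mink x x + 2 * mink x y + mink y y := by
  rw [mink_add_left, mink_add_right, mink_add_right, mink_comm y x]; ring

theorem det_gram (u w : Fin 3 → Vec) :
    (Matrix.of fun i j => mink (u i) (w j)).det = -((Matrix.of u).det * (Matrix.of w).det) := by
  have hfactor : (Matrix.of fun i j => mink (u i) (w j)) =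
      Matrix.of u * Matrix.diagonal ![-1, 1, 1] * (Matrix.of w).transpose := by
    ext i j
    simp [mink, Matrix.mul_apply, Fin.sum_univ_three, Matrix.diagonal_apply]
  rw [hfactor, Matrix.det_mul, Matrix.det_mul, Matrix.det_transpose, Matrix.det_diagonal]
  simp [Fin.prod_univ_three]

theorem mink_self_pos_of_orthogonal {p z : Vec} (hp : mink p p < 0) (hzp : mink z p = 0)
    (hz : z ≠ 0) : 0 < mink z z := by
  simp only [mink] at *
  have htime : z 0 * p 0 = z 1 * p 1 + z 2 * p 2 := by linarith
  have hcauchy : (z 0 * p 0) ^ 2 ≤ (z 1 ^ 2 + z 2 ^ 2) * (p 1 ^ 2 + p 2 ^ 2) := by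
    rw [htime]
    linarith [sq_nonneg (z 1 * p 2 - z 2 * p 1)]
  have hp' : p 1 ^ 2 + p 2 ^ 2 < p 0 ^ 2 := by linarith
  by_contra! hneg
  have hz' : z 1 ^ 2 + z 2 ^ 2 ≤ z 0 ^ 2 := by linarith
  have hspace : z 1 ^ 2 + z 2 ^ 2 = 0 := by
    by_contra hne
    nlinarith [lt_of_le_of_ne (by positivity) (Ne.symm hne)]
  have h1 : z 1 = 0 := by nlinarith [sq_nonneg (z 2)]
  have h2 : z 2 = 0 := by nlinarith [sq_nonneg (z 1)]
  have h0 : z 0 = 0 := by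
    have hp0 : p 0 ≠ 0 := by rintro h; rw [h] at hp'; nlinarith [sq_nonneg (p 1)]
    simpa [h1, h2, hp0] using htime
  exact hz (funext fun i => by fin_cases i <;> assumption)

theorem mink_self_nonneg_of_orthogonal {p z : Vec} (hp : mink p p < 0) (hzp : mink z p = 0) :
    0 ≤ mink z z := by
  rcases eq_or_ne z 0 with rfl | hz
  · simp [mink]
  · exact (mink_self_pos_of_orthogonal hp hzp hz).le

theorem mink_sq_le_of_orthogonal {p z w : Vec} (hp : mink p p < 0) (hz : mink z p = 0)
    (hw : mink w p = 0) : mink z w ^ 2 ≤ mink z z * mink w w := by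
  rcases eq_or_ne w 0 with rfl | hw0
  · simp [mink]
  have hpos := mink_self_pos_of_orthogonal hp hw hw0
  have h := mink_self_nonneg_of_orthogonal (z := mink w w • z - mink z w • w) hp
    (by rw [mink_sub_left, mink_smul_left, mink_smul_left, hz, hw]; ring)
  simp only [mink_sub_left, mink_sub_right, mink_smul_left, mink_smul_right, mink_comm w z] at h
  have h' : 0 ≤ mink w w * (mink z z * mink w w - mink z w ^ 2) := by linarith
  linarith [(mul_nonneg_iff_of_pos_left hpos).1 h']

theorem mink_nonpos_of_causal {x y : Vec} (hx : mink x x ≤ 0) (hx0 : 0 ≤ x 0)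
    (hy : mink y y ≤ 0) (hy0 : 0 ≤ y 0) : mink x y ≤ 0 := by
  simp only [mink] at *
  have hcauchy : (x 1 * y 1 + x 2 * y 2) ^ 2 ≤ (x 1 ^ 2 + x 2 ^ 2) * (y 1 ^ 2 + y 2 ^ 2) := by
    linarith [sq_nonneg (x 1 * y 2 - x 2 * y 1)]
  have hbound : (x 1 ^ 2 + x 2 ^ 2) * (y 1 ^ 2 + y 2 ^ 2) ≤ x 0 ^ 2 * y 0 ^ 2 := by
    gcongr <;> linarith
  have := abs_le_of_sq_le_sq (a := x 1 * y 1 + x 2 * y 2) (b := x 0 * y 0) (by linarith)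
    (by positivity)
  linarith [le_of_abs_le this]

theorem time_pos_of_mink_neg {x y : Vec} (hx : mink x x ≤ 0) (hx0 : 0 ≤ x 0)
    (hy : mink y y ≤ 0) (hxy : mink x y < 0) : 0 < y 0 := by
  by_contra! hy0
  have h := mink_nonpos_of_causal (y := (-1 : ℝ) • y) hx hx0
    (by rw [mink_smul_left, mink_smul_right]; linarith) (by simpa using hy0)
  rw [mink_smul_right] at h
  linarith

theorem mink_neg_of_timelike {x y : Vec} (hx : mink x x < 0) (hx0 : 0 ≤ x 0)
    (hy : mink y y ≤ 0) (hy0 : 0 < y 0) : mink x y < 0 := by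
  refine lt_of_le_of_ne (mink_nonpos_of_causal hx.le hx0 hy hy0.le) fun h => ?_
  have := mink_self_pos_of_orthogonal hx (mink_comm y x ▸ h) (by rintro rfl; simp at hy0)
  linarith

/-- A plane that contains a timelike vector is Lorentzian, so its Gram determinant is negative. -/
theorem mink_self_mul_mink_self_lt_sq {u w : Vec} {a b : ℝ} (h : LinearIndependent ℝ ![u, w])
    (hx : mink (a • u + b • w) (a • u + b • w) < 0) :
    mink u u * mink w w < mink u w ^ 2 := by
  set x := a • u + b • w with hxdef
  set z := mink x w • u - mink x u • w with hzdef
  have hzx : mink z x = 0 := by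
    rw [hzdef, mink_sub_left, mink_smul_left, mink_smul_left, mink_comm u x, mink_comm w x]
    ring
  have hz : z ≠ 0 := fun hz0 => by
    have := LinearIndependent.pair_iff.1 h (mink x w) (-mink x u) (by rw [← hz0, hzdef]; module)
    have hxx : mink x x = a * mink x u + b * mink x w := by
      nth_rw 2 [hxdef]
      rw [mink_add_right, mink_smul_right, mink_smul_right]
    rw [this.1, neg_eq_zero.1 this.2] at hxx
    linarith
  have hzz : mink z z = (mink u u * mink w w - mink u w ^ 2) * mink x x := by
    simp only [hzdef, hxdef, mink_sub_left, mink_sub_right, mink_smul_left, mink_smul_right,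
      mink_add_left, mink_add_right, mink_comm w u]
    ring
  have := mink_self_pos_of_orthogonal hx hzx hz
  rw [hzz] at this
  linarith [neg_of_mul_pos_left this hx.le]

/-! ### Distances in the hyperbolic plane -/

theorem mink_le_neg_one {x y : Vec} (hx : x ∈ hypPlane) (hy : y ∈ hypPlane) :
    mink x y ≤ -1 := by
  have hneg : mink x y < 0 :=
    mink_neg_of_timelike (by linarith [hx.1]) hx.2.le (by linarith [hy.1]) hy.2
  have h := mink_self_nonneg_of_orthogonal (p := y) (z := x + mink x y • y)
    (by linarith [hy.1]) (by rw [mink_add_left, mink_smul_left, hy.1]; ring)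
  rw [mink_self_add, mink_smul_right, mink_smul_left, mink_smul_right, hx.1, hy.1] at h
  nlinarith

theorem mem_hypPlane_of_mink_neg {x y : Vec} (hx : x ∈ hypPlane) (hy : mink y y = -1)
    (hxy : mink x y < 0) : y ∈ hypPlane :=
  ⟨hy, time_pos_of_mink_neg (by linarith [hx.1]) hx.2.le (by linarith) hxy⟩

theorem toHyp_mem_hypPlane {x : Vec} (hx : mink x x < 0) (hx0 : 0 < x 0) :
    toHyp x ∈ hypPlane := by
  have hs : 0 < √(-mink x x) := Real.sqrt_pos.2 (by linarith)
  refine ⟨?_, mul_pos (inv_pos.2 hs) hx0⟩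
  rw [toHyp, mink_smul_left, mink_smul_right, ← mul_assoc, ← mul_inv,
    Real.mul_self_sqrt (by linarith), inv_neg, neg_mul, inv_mul_cancel₀ hx.ne]

theorem cosh_hypDist {x y : Vec} (hx : x ∈ hypPlane) (hy : y ∈ hypPlane) :
    Real.cosh (hypDist x y) = -mink x y :=
  Real.cosh_arcosh (by linarith [mink_le_neg_one hx hy])

theorem hypDist_nonneg {x y : Vec} (hx : x ∈ hypPlane) (hy : y ∈ hypPlane) :
    0 ≤ hypDist x y :=
  Real.arcosh_nonneg (by linarith [mink_le_neg_one hx hy])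

theorem hypDist_eq_of_mink_eq {x y : Vec} {t : ℝ} (ht : 0 ≤ t) (h : mink x y = -Real.cosh t) :
    hypDist x y = t := by
  rw [hypDist, h, neg_neg, Real.arcosh_cosh ht]

theorem setDist_eq_hypDist {A B : Set Vec} {x y : Vec} (hA : A ⊆ hypPlane) (hB : B ⊆ hypPlane)
    (hx : x ∈ A) (hy : y ∈ B) (h : ∀ a ∈ A, ∀ b ∈ B, mink a b ≤ mink x y) :
    setDist A B = hypDist x y := by
  refine IsLeast.csInf_eq ⟨⟨x, hx, y, hy, rfl⟩, ?_⟩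
  rintro d ⟨a, ha, b, hb, rfl⟩
  have hxy := mink_le_neg_one (hA hx) (hB hy)
  have hab := mink_le_neg_one (hA ha) (hB hb)
  exact (Real.arcosh_le_arcosh (by linarith) (by linarith)).2 (by linarith [h a ha b hb])

/-- The two points project orthogonally to `P` and `Q` on a geodesic, and this projection does not
increase distances. -/
theorem mink_le_of_orthogonal {P Q z w : Vec} {a c : ℝ} (hP : P ∈ hypPlane) (hQ : Q ∈ hypPlane)
    (hzP : mink z P = 0) (hzQ : mink z Q = 0) (hwP : mink w P = 0) (hwQ : mink w Q = 0)
    (hz : a • P + z ∈ hypPlane) (hw : c • Q + w ∈ hypPlane) :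
    mink (a • P + z) (c • Q + w) ≤ mink P Q := by
  have hprod : mink (a • P + z) (c • Q + w) = a * c * mink P Q + mink z w := by
    simp only [mink_add_left, mink_add_right, mink_smul_left, mink_smul_right, hzQ,
      mink_comm P w, hwP]
    ring
  have ha : 1 ≤ a := by
    have := mink_le_neg_one hz hP
    rw [mink_add_left, mink_smul_left, hP.1, hzP] at this
    linarith
  have hc : 1 ≤ c := by
    have := mink_le_neg_one hw hQ
    rw [mink_add_left, mink_smul_left, hQ.1, hwQ] at this
    linarith
  have hzz : mink z z = a ^ 2 - 1 := by
    have := hz.1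
    rw [mink_self_add, mink_smul_left, mink_smul_left, mink_smul_right, hP.1, mink_comm P z,
      hzP] at this
    linarith
  have hww : mink w w = c ^ 2 - 1 := by
    have := hw.1
    rw [mink_self_add, mink_smul_left, mink_smul_left, mink_smul_right, hQ.1, mink_comm Q w,
      hwQ] at this
    linarith
  have hcauchy := mink_sq_le_of_orthogonal (by linarith [hP.1]) hzP hwP
  rw [hzz, hww] at hcauchy
  have hzw : mink z w ≤ a * c - 1 :=
    le_of_abs_le (abs_le_of_sq_le_sq (by nlinarith [sq_nonneg (a - c)]) (by nlinarith))
  have hPQ := mink_le_neg_one hP hQ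
  rw [hprod]
  nlinarith [mul_nonneg (sub_nonneg.2 ha) (sub_nonneg.2 hc)]

/-- The geodesic of `ℍ²` cut out by the projective line through `u` and `w`. -/
def geodesic (u w : Vec) : Set Vec := {x | x ∈ hypPlane ∧ x ∈ Submodule.span ℝ {u, w}}

theorem geodesic_comm (u w : Vec) : geodesic u w = geodesic w u := by
  rw [geodesic, geodesic, Set.pair_comm]

theorem geodesic_subset_hypPlane (u w : Vec) : geodesic u w ⊆ hypPlane := fun _ hx => hx.1

theorem geodesic_subset_geodesic {u w p m : Vec} (hu : u ∈ Submodule.span ℝ {p, m})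
    (hw : w ∈ Submodule.span ℝ {p, m}) : geodesic u w ⊆ geodesic p m :=
  fun _ hx => ⟨hx.1, Submodule.span_le.2 (Set.pair_subset hu hw) hx.2⟩

theorem setDist_geodesic_eq_of_perpendicular {u P Q : Vec} (hP : P ∈ hypPlane)
    (hQ : Q ∈ hypPlane) (hPu : mink u P = 0) (hQu : mink u Q = 0) :
    setDist (geodesic u P) (geodesic u Q) = hypDist P Q := by
  refine setDist_eq_hypDist (geodesic_subset_hypPlane u P) (geodesic_subset_hypPlane u Q)
    ⟨hP, Submodule.subset_span (by simp)⟩ ⟨hQ, Submodule.subset_span (by simp)⟩ ?_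
  rintro x ⟨hx, hx'⟩ y ⟨hy, hy'⟩
  obtain ⟨a, b, rfl⟩ := Submodule.mem_span_pair.1 hx'
  obtain ⟨c, d, rfl⟩ := Submodule.mem_span_pair.1 hy'
  rw [add_comm] at hx hy
  rw [add_comm (a • u), add_comm (c • u)]
  apply mink_le_of_orthogonal hP hQ <;> simp only [mink_smul_left, hPu, hQu, mul_zero, hx, hy]

/-! ### Null frames -/

/-- Two future null vectors with product `-1/2`: the ideal end points of a geodesic with a choice
of scale, which fixes the origin `p + m` of the arc length parameter on this geodesic. -/
structure NullFrame (p m : Vec) : Prop where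
  null_left : mink p p = 0
  null_right : mink m m = 0
  mink_eq : mink p m = -1 / 2
  time_left : 0 < p 0
  time_right : 0 < m 0

/-- The arc length parametrization, from `m` to `p`, of the geodesic with a null frame `p, m`. -/
def geodesicPoint (p m : Vec) (t : ℝ) : Vec := Real.exp t • p + Real.exp (-t) • m

theorem mink_geodesicPoint {p m : Vec} (x : Vec) (t : ℝ) :
    mink x (geodesicPoint p m t) = Real.exp t * mink x p + Real.exp (-t) * mink x m := by
  rw [geodesicPoint, mink_add_right, mink_smul_right, mink_smul_right]

theorem geodesicPoint_flip (p m : Vec) (L t : ℝ) :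
    geodesicPoint (Real.exp (-L) • m) (Real.exp L • p) t = geodesicPoint p m (L - t) := by
  rw [geodesicPoint, geodesicPoint, smul_smul, smul_smul, ← Real.exp_add, ← Real.exp_add,
    add_comm]
  ring_nf

theorem geodesic_flip (p m : Vec) (L : ℝ) :
    geodesic (Real.exp (-L) • m) (Real.exp L • p) = geodesic p m := by
  rw [geodesic_comm]
  simp only [geodesic, Submodule.span_insert,
    Submodule.span_singleton_smul_eq (IsUnit.mk0 _ (Real.exp_ne_zero _))]

namespace NullFrame

variable {p m : Vec}

/-- The same geodesic, with the direction reversed and the origin moved to the point of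
parameter `L`. -/
theorem flip (h : NullFrame p m) (L : ℝ) :
    NullFrame (Real.exp (-L) • m) (Real.exp L • p) where
  null_left := by rw [mink_smul_left, mink_smul_right, h.null_right, mul_zero, mul_zero]
  null_right := by rw [mink_smul_left, mink_smul_right, h.null_left, mul_zero, mul_zero]
  mink_eq := by
    rw [mink_smul_left, mink_smul_right, mink_comm m p, h.mink_eq, ← mul_assoc, ← Real.exp_add,
      neg_add_cancel, Real.exp_zero, one_mul]
  time_left := mul_pos (Real.exp_pos _) h.time_right
  time_right := mul_pos (Real.exp_pos _) h.time_left

theorem mink_geodesicPoint_left (h : NullFrame p m) (t : ℝ) :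
    mink (geodesicPoint p m t) p = -Real.exp (-t) / 2 := by
  rw [mink_comm, mink_geodesicPoint, h.null_left, h.mink_eq]; ring

theorem mink_geodesicPoint_right (h : NullFrame p m) (t : ℝ) :
    mink (geodesicPoint p m t) m = -Real.exp t / 2 := by
  rw [mink_comm, mink_geodesicPoint, h.null_right, mink_comm, h.mink_eq]; ring

theorem mink_geodesicPoint_geodesicPoint (h : NullFrame p m) (s t : ℝ) :
    mink (geodesicPoint p m s) (geodesicPoint p m t) = -Real.cosh (t - s) := by
  rw [mink_geodesicPoint, h.mink_geodesicPoint_left, h.mink_geodesicPoint_right, Real.cosh_eq,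
    neg_sub, Real.exp_sub, Real.exp_sub, Real.exp_neg, Real.exp_neg]
  ring

theorem geodesicPoint_mem_hypPlane (h : NullFrame p m) (t : ℝ) :
    geodesicPoint p m t ∈ hypPlane := by
  refine ⟨by rw [h.mink_geodesicPoint_geodesicPoint, sub_self, Real.cosh_zero], ?_⟩
  have := h.time_left
  have := h.time_right
  simp only [geodesicPoint, Pi.add_apply, Pi.smul_apply, smul_eq_mul]
  positivity

theorem geodesicPoint_mem_geodesic (h : NullFrame p m) (t : ℝ) :
    geodesicPoint p m t ∈ geodesic p m :=
  ⟨h.geodesicPoint_mem_hypPlane t, Submodule.mem_span_pair.2 ⟨_, _, rfl⟩⟩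

theorem mink_left_neg (h : NullFrame p m) {x : Vec} (hx : x ∈ hypPlane) : mink x p < 0 :=
  mink_neg_of_timelike (by linarith [hx.1]) hx.2.le h.null_left.le h.time_left

theorem mink_right_neg (h : NullFrame p m) {x : Vec} (hx : x ∈ hypPlane) : mink x m < 0 :=
  mink_neg_of_timelike (by linarith [hx.1]) hx.2.le h.null_right.le h.time_right

theorem exists_foot (h : NullFrame p m) {x : Vec} (hx : x ∈ hypPlane) :
    ∃ (t a : ℝ) (z : Vec),
      0 < a ∧ x = a • geodesicPoint p m t + z ∧ mink z p = 0 ∧ mink z m = 0 := by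
  have hα : 0 < -2 * mink x m := by linarith [h.mink_right_neg hx]
  have hβ : 0 < -2 * mink x p := by linarith [h.mink_left_neg hx]
  set α := -2 * mink x m
  set β := -2 * mink x p
  have ha : 0 < √(α * β) := Real.sqrt_pos.2 (mul_pos hα hβ)
  have hpoint : √(α * β) • geodesicPoint p m (Real.log (α / √(α * β))) = α • p + β • m := by
    rw [geodesicPoint, Real.exp_neg, Real.exp_log (div_pos hα ha), smul_add, smul_smul, smul_smul,
      mul_div_cancel₀ _ ha.ne', inv_div, mul_div_assoc', Real.mul_self_sqrt (mul_pos hα hβ).le,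
      mul_div_cancel_left₀ _ hα.ne']
  refine ⟨_, _, x - (α • p + β • m), ha, by rw [hpoint]; module, ?_, ?_⟩
  · rw [mink_sub_left, mink_add_left, mink_smul_left, mink_smul_left, h.null_left, mink_comm m p,
      h.mink_eq]
    linarith
  · rw [mink_sub_left, mink_add_left, mink_smul_left, mink_smul_left, h.null_right, h.mink_eq]
    linarith

theorem exists_geodesicPoint_eq (h : NullFrame p m) {x : Vec} (hx : x ∈ geodesic p m) :
    ∃ t, x = geodesicPoint p m t := by
  obtain ⟨a, b, rfl⟩ := Submodule.mem_span_pair.1 hx.2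
  have ha : 0 < a := by
    have := h.mink_right_neg hx.1
    rw [mink_add_left, mink_smul_left, mink_smul_left, h.null_right, h.mink_eq] at this
    linarith
  have hab : a * b = 1 := by
    have := hx.1.1
    rw [mink_self_add, mink_smul_left, mink_smul_left, mink_smul_left, mink_smul_right,
      mink_smul_right, mink_smul_right, h.null_left, h.null_right, h.mink_eq] at this
    linarith
  refine ⟨Real.log a, ?_⟩
  rw [geodesicPoint, Real.exp_neg, Real.exp_log ha, eq_inv_of_mul_eq_one_right hab]

/-- The hypotheses on `x` and `y` say that the parameters of their feet are at most `0` and at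
least `L`. -/
theorem mink_le_neg_cosh (h : NullFrame p m) {x y : Vec} {L : ℝ} (hL : 0 ≤ L)
    (hx : x ∈ hypPlane) (hy : y ∈ hypPlane) (hxpm : mink x p ≤ mink x m)
    (hypm : Real.exp (-L) * mink y m ≤ Real.exp L * mink y p) :
    mink x y ≤ -Real.cosh L := by
  obtain ⟨s, a, z, ha, rfl, hzp, hzm⟩ := h.exists_foot hx
  obtain ⟨t, b, w, hb, rfl, hwp, hwm⟩ := h.exists_foot hy
  have hs : s ≤ 0 := by
    rw [mink_add_left, mink_add_left, mink_smul_left, mink_smul_left, hzp, hzm,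
      h.mink_geodesicPoint_left, h.mink_geodesicPoint_right] at hxpm
    have : Real.exp s ≤ Real.exp (-s) := by nlinarith
    linarith [Real.exp_le_exp.1 this]
  have ht : L ≤ t := by
    rw [mink_add_left, mink_add_left, mink_smul_left, mink_smul_left, hwp, hwm,
      h.mink_geodesicPoint_left, h.mink_geodesicPoint_right] at hypm
    have : Real.exp L * Real.exp (-t) ≤ Real.exp (-L) * Real.exp t := by nlinarith
    rw [← Real.exp_add, ← Real.exp_add] at this
    linarith [Real.exp_le_exp.1 this]
  have horth : ∀ {z : Vec} (r : ℝ), mink z p = 0 → mink z m = 0 →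
      mink z (geodesicPoint p m r) = 0 := fun r hp hm => by
    rw [mink_geodesicPoint, hp, hm, mul_zero, mul_zero, add_zero]
  calc mink (a • geodesicPoint p m s + z) (b • geodesicPoint p m t + w)
      ≤ mink (geodesicPoint p m s) (geodesicPoint p m t) :=
        mink_le_of_orthogonal (h.geodesicPoint_mem_hypPlane s) (h.geodesicPoint_mem_hypPlane t)
          (horth s hzp hzm) (horth t hzp hzm) (horth s hwp hwm) (horth t hwp hwm) hx hy
    _ = -Real.cosh (t - s) := h.mink_geodesicPoint_geodesicPoint s t
    _ ≤ -Real.cosh L := neg_le_neg (Real.cosh_le_cosh.2 (by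
        rw [abs_of_nonneg hL, abs_of_nonneg (by linarith)]; linarith))

end NullFrame

/-! ### The bodies of two vertices and their distance -/

/-- The body of a vertex `u` normalised to `⟨u, u⟩ ∈ {-1, 0, 1}`, by one formula for the three
types: the point `u` itself, the horodisc of level `1/2`, or the half plane beyond the polar
geodesic. -/
def unitBody (u : Vec) : Set Vec := {x | x ∈ hypPlane ∧ -mink x u ≤ (1 - mink u u) / 2}

/-- The boundary of `unitBody u`: the point `u`, the horocycle, or the polar geodesic. -/
def unitBodyBoundary (u : Vec) : Set Vec := {x | x ∈ hypPlane ∧ -mink x u = (1 - mink u u) / 2}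

theorem unitBodyBoundary_subset_unitBody (u : Vec) : unitBodyBoundary u ⊆ unitBody u :=
  fun _ hx => ⟨hx.1, hx.2.le⟩

theorem unitBody_eq_singleton {u : Vec} (hu : u ∈ hypPlane) : unitBody u = {u} := by
  ext x
  rw [Set.mem_singleton_iff]
  refine ⟨fun ⟨hx, hxu⟩ => ?_, ?_⟩
  · have hone : mink x u = -1 := le_antisymm (mink_le_neg_one hx hu) (by linarith [hu.1])
    have hperp : mink (x - u) u = 0 := by rw [mink_sub_left, hone, hu.1]; ring
    have hzero : mink (x - u) (x - u) = 0 := by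
      simp only [mink_sub_left, mink_sub_right, mink_comm u x, hone, hx.1, hu.1]; ring
    by_contra hne
    have := mink_self_pos_of_orthogonal (by linarith [hu.1]) hperp (sub_ne_zero.2 hne)
    linarith
  · rintro rfl
    exact ⟨hu, by linarith [hu.1]⟩

theorem unitBodyBoundary_eq_singleton {u : Vec} (hu : u ∈ hypPlane) :
    unitBodyBoundary u = {u} := by
  refine subset_antisymm (fun x hx => ?_) ?_
  · rw [← unitBody_eq_singleton hu]
    exact ⟨hx.1, hx.2.le⟩
  · rintro x rfl
    exact ⟨hu, by linarith [hu.1]⟩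

namespace NullFrame

variable {p m : Vec} {e f L : ℝ}

theorem mink_add_smul_self (h : NullFrame p m) (e : ℝ) :
    mink (m + e • p) (m + e • p) = -e := by
  rw [mink_self_add, mink_smul_right, mink_smul_left, mink_smul_right, h.null_left, h.null_right,
    mink_comm, h.mink_eq]
  ring

theorem mink_geodesicPoint_add_smul (h : NullFrame p m) (e t : ℝ) :
    mink (geodesicPoint p m t) (m + e • p) = -(Real.exp t + e * Real.exp (-t)) / 2 := by
  rw [mink_add_right, mink_smul_right, h.mink_geodesicPoint_left, h.mink_geodesicPoint_right]
  ring

theorem geodesicPoint_zero_mem_unitBodyBoundary (h : NullFrame p m) (e : ℝ) :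
    geodesicPoint p m 0 ∈ unitBodyBoundary (m + e • p) := by
  refine ⟨h.geodesicPoint_mem_hypPlane 0, ?_⟩
  rw [h.mink_geodesicPoint_add_smul, h.mink_add_smul_self, neg_zero, Real.exp_zero]
  ring

theorem geodesicPoint_mem_unitBody (h : NullFrame p m) {t : ℝ} (he : e ≤ 0) (ht : t ≤ 0) :
    geodesicPoint p m t ∈ unitBody (m + e • p) := by
  refine ⟨h.geodesicPoint_mem_hypPlane t, ?_⟩
  rw [h.mink_geodesicPoint_add_smul, h.mink_add_smul_self]
  nlinarith [Real.exp_le_one_iff.2 ht, Real.one_le_exp (neg_nonneg.2 ht)]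

theorem unitBodyBoundary_inter_geodesic (h : NullFrame p m) (he : e ≤ 0 ∨ e = 1) :
    unitBodyBoundary (m + e • p) ∩ geodesic p m = {geodesicPoint p m 0} := by
  refine subset_antisymm ?_ (Set.singleton_subset_iff.2
    ⟨h.geodesicPoint_zero_mem_unitBodyBoundary e, h.geodesicPoint_mem_geodesic 0⟩)
  rintro x ⟨⟨-, hxb⟩, hxg⟩
  obtain ⟨t, rfl⟩ := h.exists_geodesicPoint_eq hxg
  rw [h.mink_geodesicPoint_add_smul, h.mink_add_smul_self, Real.exp_neg] at hxb
  have hfactor : (Real.exp t - 1) * (Real.exp t - e) = 0 := by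
    field_simp at hxb
    linarith
  have hone : Real.exp t = 1 := by
    rcases mul_eq_zero.1 hfactor with h1 | h1
    · linarith
    · rcases he with he | rfl
      · linarith [Real.exp_pos t]
      · linarith
  rw [Set.mem_singleton_iff, Real.exp_eq_one_iff t |>.1 hone]

/-- The body of `m + e • p` lies beyond the perpendicular to the geodesic at its origin. -/
theorem mink_left_le_mink_right_of_mem_unitBody (h : NullFrame p m) (he : -1 ≤ e) (he' : e ≤ 1)
    {x : Vec} (hx : x ∈ unitBody (m + e • p)) : mink x p ≤ mink x m := by
  obtain ⟨hxH, hxb⟩ := hx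
  rw [h.mink_add_smul_self, mink_add_right, mink_smul_right] at hxb
  have hp := h.mink_left_neg hxH
  have hm := h.mink_right_neg hxH
  have hprod : 1 / 4 ≤ mink x m * mink x p := by
    obtain ⟨t, a, z, -, rfl, hzp, hzm⟩ := h.exists_foot hxH
    have ha := mink_le_neg_one hxH (h.geodesicPoint_mem_hypPlane t)
    rw [mink_add_left, mink_smul_left, (h.geodesicPoint_mem_hypPlane t).1, mink_geodesicPoint,
      hzp, hzm] at ha
    rw [mink_add_left, mink_add_left, mink_smul_left, mink_smul_left, hzp, hzm,
      h.mink_geodesicPoint_left, h.mink_geodesicPoint_right, Real.exp_neg]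
    calc 1 / 4 ≤ a ^ 2 / 4 := by nlinarith
      _ = _ := by field_simp; ring
  have hsum : mink x m + mink x p ≤ -1 := by nlinarith [sq_nonneg (mink x m - mink x p)]
  rcases he'.lt_or_eq with he1 | rfl
  · nlinarith
  · nlinarith [sq_nonneg (mink x m - mink x p)]

theorem mink_le_neg_cosh_of_mem_unitBody (h : NullFrame p m) (he : -1 ≤ e) (he' : e ≤ 1)
    (hf : -1 ≤ f) (hf' : f ≤ 1) (hL : 0 ≤ L) {x y : Vec} (hx : x ∈ unitBody (m + e • p))
    (hy : y ∈ unitBody (Real.exp L • p + f • Real.exp (-L) • m)) :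
    mink x y ≤ -Real.cosh L := by
  have hy' := (h.flip L).mink_left_le_mink_right_of_mem_unitBody hf hf' hy
  rw [mink_smul_right, mink_smul_right] at hy'
  exact h.mink_le_neg_cosh hL hx.1 hy.1 (h.mink_left_le_mink_right_of_mem_unitBody he he' hx) hy'

theorem unitBody_inter_eq_empty (h : NullFrame p m) (he : -1 ≤ e) (he' : e ≤ 1)
    (hf : -1 ≤ f) (hf' : f ≤ 1) (hL : 0 < L) :
    unitBody (m + e • p) ∩ unitBody (Real.exp L • p + f • Real.exp (-L) • m) = ∅ := by
  rw [Set.eq_empty_iff_forall_notMem]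
  rintro x ⟨hx, hx'⟩
  have := h.mink_le_neg_cosh_of_mem_unitBody he he' hf hf' hL.le hx hx'
  linarith [hx.1.1, Real.one_lt_cosh.2 hL.ne']

theorem setDist_unitBody (h : NullFrame p m) (he : -1 ≤ e) (he' : e ≤ 1)
    (hf : -1 ≤ f) (hf' : f ≤ 1) (hL : 0 ≤ L) :
    setDist (unitBody (m + e • p)) (unitBody (Real.exp L • p + f • Real.exp (-L) • m)) = L := by
  have hdist : mink (geodesicPoint p m 0) (geodesicPoint p m L) = -Real.cosh L := by
    rw [h.mink_geodesicPoint_geodesicPoint, sub_zero]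
  have hx := h.geodesicPoint_zero_mem_unitBodyBoundary e
  have hy := (h.flip L).geodesicPoint_zero_mem_unitBodyBoundary f
  rw [geodesicPoint_flip, sub_zero] at hy
  rw [setDist_eq_hypDist (fun x hx => hx.1) (fun y hy => hy.1)
    (unitBodyBoundary_subset_unitBody _ hx) (unitBodyBoundary_subset_unitBody _ hy),
    hypDist_eq_of_mink_eq hL hdist]
  intro a ha b hb
  rw [hdist]
  exact h.mink_le_neg_cosh_of_mem_unitBody he he' hf hf' hL ha hb

theorem unitBody_inter_nonempty (h : NullFrame p m) (hef : e ≤ 0 ∨ f ≤ 0) (hL : L ≤ 0) :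
    (unitBody (m + e • p) ∩ unitBody (Real.exp L • p + f • Real.exp (-L) • m)).Nonempty := by
  rcases hef with he | hf
  · have hy := (h.flip L).geodesicPoint_zero_mem_unitBodyBoundary f
    rw [geodesicPoint_flip, sub_zero] at hy
    exact ⟨_, h.geodesicPoint_mem_unitBody he hL, unitBodyBoundary_subset_unitBody _ hy⟩
  · have hx := h.geodesicPoint_zero_mem_unitBodyBoundary e
    have hy := (h.flip L).geodesicPoint_mem_unitBody hf hL
    rw [geodesicPoint_flip, sub_self] at hy
    exact ⟨_, unitBodyBoundary_subset_unitBody _ hx, hy⟩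

theorem setDist_unitBodyBoundary (h : NullFrame p m) (he : e ≤ 0 ∨ e = 1) (hf : f ≤ 0 ∨ f = 1)
    (hL : L ≤ 0) :
    setDist (unitBodyBoundary (m + e • p) ∩ geodesic p m)
      (unitBodyBoundary (Real.exp L • p + f • Real.exp (-L) • m) ∩ geodesic p m) = -L := by
  have hy := (h.flip L).unitBodyBoundary_inter_geodesic hf
  rw [geodesic_flip, geodesicPoint_flip, sub_zero] at hy
  rw [h.unitBodyBoundary_inter_geodesic he, hy,
    setDist_eq_hypDist (x := geodesicPoint p m 0) (y := geodesicPoint p m L)]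
  · apply hypDist_eq_of_mink_eq (neg_nonneg.2 hL)
    rw [h.mink_geodesicPoint_geodesicPoint, sub_zero, Real.cosh_neg]
  · simpa using h.geodesicPoint_mem_hypPlane 0
  · simpa using h.geodesicPoint_mem_hypPlane L
  · rfl
  · rfl
  · rintro a rfl b rfl
    rfl

end NullFrame

/-! ### The length of an edge -/

section Tau

variable {s c : ℝ}

theorem add_sqrt_sq_sub_pos (hc : 0 < c) : 0 < c + √(c ^ 2 - s) :=
  add_pos_of_pos_of_nonneg hc (Real.sqrt_nonneg _)

theorem mul_exp_neg_log_add_sqrt (hc : 0 < c) (hs : s ≤ c ^ 2) :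
    s * Real.exp (-Real.log (c + √(c ^ 2 - s))) = c - √(c ^ 2 - s) := by
  rw [Real.exp_neg, Real.exp_log (add_sqrt_sq_sub_pos hc), ← div_eq_mul_inv,
    div_eq_iff (add_sqrt_sq_sub_pos hc).ne']
  linarith [Real.sq_sqrt (sub_nonneg.2 hs)]

theorem tau'_log_add_sqrt (hc : 0 < c) (hs : s ≤ c ^ 2) :
    tau' s (Real.log (c + √(c ^ 2 - s))) = c := by
  rw [tau'_eq, mul_assoc, mul_exp_neg_log_add_sqrt hc hs, Real.exp_log (add_sqrt_sq_sub_pos hc)]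
  ring

theorem tau_log_add_sqrt (hc : 0 < c) (hs : s ≤ c ^ 2) :
    tau s (Real.log (c + √(c ^ 2 - s))) = √(c ^ 2 - s) := by
  rw [tau, mul_assoc, mul_exp_neg_log_add_sqrt hc hs, Real.exp_log (add_sqrt_sq_sub_pos hc)]
  ring

theorem tau_one (L : ℝ) : tau 1 L = Real.sinh L := by
  rw [tau, Real.sinh_eq]; ring

end Tau

/-- The last two equations, solved for `p` and `m`, give the witnesses. -/
theorem exists_null_pair {u w : Vec} {e f L : ℝ} (hu : mink u u = -e) (hw : mink w w = -f)
    (huw : mink u w = -tau' (e * f) L) (hL : tau (e * f) L ≠ 0) :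
    ∃ p ∈ Submodule.span ℝ {u, w}, ∃ m ∈ Submodule.span ℝ {u, w},
      mink p p = 0 ∧ mink m m = 0 ∧ mink p m = -1 / 2 ∧
      u = m + e • p ∧ w = Real.exp L • p + f • Real.exp (-L) • m := by
  set E := Real.exp L with hE
  set F := Real.exp (-L) with hF
  have hEF : E * F = 1 := by rw [hE, hF, ← Real.exp_add, add_neg_cancel, Real.exp_zero]
  obtain ⟨κ, hκ⟩ : ∃ κ, κ * (E - e * f * F) = 1 := by
    refine ⟨(2 * tau (e * f) L)⁻¹, ?_⟩
    have : E - e * f * F = 2 * tau (e * f) L := by rw [tau]; ring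
    rw [this, inv_mul_cancel₀ (mul_ne_zero two_ne_zero hL)]
  rw [tau'_eq, ← hE, ← hF] at huw
  refine ⟨κ • (w - (f * F) • u), Submodule.mem_span_pair.2 ⟨-κ * (f * F), κ, by module⟩,
    κ • (E • u - e • w), Submodule.mem_span_pair.2 ⟨κ * E, -κ * e, by module⟩, ?_, ?_, ?_,
    by linear_combination (norm := module) (-hκ) • u,
    by linear_combination (norm := module) (-hκ) • w⟩ <;>
  simp only [mink_sub_left, mink_sub_right, mink_smul_left, mink_smul_right, mink_comm w u, hu,
      hw, huw]
  · linear_combination κ ^ 2 * f * hEF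
  · linear_combination κ ^ 2 * e ^ 2 * f * hEF
  · linear_combination -κ ^ 2 * e * f * hEF - 1 / 2 * (κ * (E - e * f * F) + 1) * hκ

theorem exists_exp_add_mul_exp_neg_pos {e f L : ℝ} (he : 0 ≤ e ∨ e = -1) (hf : 0 ≤ f ∨ f = -1)
    (hL : 0 < tau (e * f) L) :
    ∃ t, 0 < Real.exp t + e * Real.exp (-t) ∧
      0 < Real.exp (L - t) + f * Real.exp (-(L - t)) := by
  have hpos {e t : ℝ} (he : 0 ≤ e) : 0 < Real.exp t + e * Real.exp (-t) := by positivity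
  have hneg {t : ℝ} (ht : 0 < t) : 0 < Real.exp t + -1 * Real.exp (-t) := by
    linarith [Real.exp_lt_exp.2 (neg_lt_self ht)]
  rcases he with he | rfl <;> rcases hf with hf | rfl
  · exact ⟨0, hpos he, hpos hf⟩
  · exact ⟨L - 1, hpos he, hneg (by linarith)⟩
  · exact ⟨1, hneg one_pos, hpos hf⟩
  · rw [neg_one_mul, neg_neg, tau_one, Real.sinh_pos_iff] at hL
    exact ⟨L / 2, hneg (half_pos hL), hneg (by linarith)⟩

theorem nullFrame_of_mink_geodesicPoint_neg {p m x : Vec} {t : ℝ} (hp : mink p p = 0)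
    (hm : mink m m = 0) (hpm : mink p m = -1 / 2) (hx : x ∈ hypPlane)
    (hxt : mink x (geodesicPoint p m t) < 0) : NullFrame p m := by
  have hself : mink (geodesicPoint p m t) (geodesicPoint p m t) = -1 := by
    rw [geodesicPoint, mink_self_add, mink_smul_left, mink_smul_left, mink_smul_left,
      mink_smul_right, mink_smul_right, mink_smul_right, hp, hm, hpm, Real.exp_neg]
    field_simp
    ring
  have hmem := mem_hypPlane_of_mink_neg hx hself hxt
  refine ⟨hp, hm, hpm, time_pos_of_mink_neg (by linarith [hmem.1]) hmem.2.le hp.le ?_,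
    time_pos_of_mink_neg (by linarith [hmem.1]) hmem.2.le hm.le ?_⟩
  · rw [mink_comm, mink_geodesicPoint, hp, hpm]
    linarith [Real.exp_pos (-t)]
  · rw [mink_comm, mink_geodesicPoint, hm, mink_comm, hpm]
    linarith [Real.exp_pos t]

theorem exists_nullFrame {u w : Vec} {e f L a b : ℝ} (hu : mink u u = -e) (hw : mink w w = -f)
    (huw : mink u w = -tau' (e * f) L) (he : 0 ≤ e ∨ e = -1) (hf : 0 ≤ f ∨ f = -1)
    (hL : 0 < tau (e * f) L) (ha : 0 ≤ a) (hb : 0 ≤ b) (hx : a • u + b • w ∈ hypPlane) :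
    ∃ p m, NullFrame p m ∧ u = m + e • p ∧ w = Real.exp L • p + f • Real.exp (-L) • m ∧
      geodesic u w = geodesic p m := by
  obtain ⟨p, hp, m, hm, hpp, hmm, hpm, hueq, hweq⟩ := exists_null_pair hu hw huw hL.ne'
  obtain ⟨t, htu, htw⟩ := exists_exp_add_mul_exp_neg_pos he hf hL
  have hut : mink u (geodesicPoint p m t) < 0 := by
    rw [mink_geodesicPoint, hueq, mink_add_left, mink_add_left, mink_smul_left, mink_smul_left,
      mink_comm m p, hpp, hmm, hpm]
    linarith
  have hwt : mink w (geodesicPoint p m t) < 0 := by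
    rw [neg_sub, sub_eq_add_neg, sub_eq_add_neg, Real.exp_add, Real.exp_add] at htw
    simp only [mink_geodesicPoint, hweq, mink_add_left, mink_smul_left, mink_comm m p, hpp, hmm,
      hpm]
    linarith
  have hab : 0 < a ∨ 0 < b := by
    by_contra! hn
    have := hx.2
    simp [le_antisymm hn.1 ha, le_antisymm hn.2 hb] at this
  have hxt : mink (a • u + b • w) (geodesicPoint p m t) < 0 := by
    rw [mink_add_left, mink_smul_left, mink_smul_left]
    rcases hab with h | h <;> nlinarith
  refine ⟨p, m, nullFrame_of_mink_geodesicPoint_neg hpp hmm hpm hx hxt, hueq, hweq,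
    subset_antisymm (geodesic_subset_geodesic ?_ ?_) (geodesic_subset_geodesic hp hm)⟩
  · exact Submodule.mem_span_pair.2 ⟨e, 1, by rw [hueq]; module⟩
  · exact Submodule.mem_span_pair.2 ⟨Real.exp L, f * Real.exp (-L), by rw [hweq]; module⟩

open Classical in
/-- The generalized length of the segment between two vertices normalised to
`⟨u, u⟩, ⟨w, w⟩ ∈ {-1, 0, 1}`. -/
def segmentLength (u w : Vec) : ℝ :=
  if unitBody u ∩ unitBody w = ∅ then setDist (unitBody u) (unitBody w)
  else -setDist (unitBodyBoundary u ∩ geodesic u w) (unitBodyBoundary w ∩ geodesic u w)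

theorem segmentLength_eq {u w : Vec} {e f L a b : ℝ} (hu : mink u u = -e) (hw : mink w w = -f)
    (huw : mink u w = -tau' (e * f) L) (he : e = 1 ∨ e = 0 ∨ e = -1) (hf : f = 1 ∨ f = 0 ∨ f = -1)
    (hL : 0 < tau (e * f) L) (ha : 0 ≤ a) (hb : 0 ≤ b) (hx : a • u + b • w ∈ hypPlane) :
    segmentLength u w = L := by
  obtain ⟨p, m, h, rfl, rfl, hgeod⟩ := exists_nullFrame hu hw huw (by grind) (by grind) hL ha hb hx
  rw [segmentLength, hgeod]
  rcases lt_or_ge 0 L with hL0 | hL0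
  · rw [if_pos (h.unitBody_inter_eq_empty (by grind) (by grind) (by grind) (by grind) hL0),
      h.setDist_unitBody (by grind) (by grind) (by grind) (by grind) hL0.le]
  · have hef : e ≤ 0 ∨ f ≤ 0 := by
      by_contra! hpos
      obtain ⟨rfl, rfl⟩ : e = 1 ∧ f = 1 := by grind
      rw [one_mul, tau_one, Real.sinh_pos_iff] at hL
      exact hL0.not_gt hL
    rw [if_neg (h.unitBody_inter_nonempty hef hL0).ne_empty,
      h.setDist_unitBodyBoundary (by grind) (by grind) hL0, neg_neg]

theorem segmentLength_eq_log {u w : Vec} {e f a b : ℝ} (hu : mink u u = -e) (hw : mink w w = -f)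
    (he : e = 1 ∨ e = 0 ∨ e = -1) (hf : f = 1 ∨ f = 0 ∨ f = -1) (huw : mink u w < 0)
    (hef : e * f < mink u w ^ 2) (ha : 0 ≤ a) (hb : 0 ≤ b) (hx : a • u + b • w ∈ hypPlane) :
    segmentLength u w = Real.log (-mink u w + √((-mink u w) ^ 2 - e * f)) := by
  rw [← neg_sq] at hef
  refine segmentLength_eq hu hw ?_ he hf ?_ ha hb hx
  · rw [tau'_log_add_sqrt (neg_pos.2 huw) hef.le, neg_neg]
  · rw [tau_log_add_sqrt (neg_pos.2 huw) hef.le]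
    exact Real.sqrt_pos.2 (sub_pos.2 hef)

/-! ### Generalized triangles -/

/-- `i, j, k` are the three indices of `Fin 3` in some order. -/
structure IsLabelling (i j k : Fin 3) : Prop where
  ne_ij : i ≠ j
  ne_jk : j ≠ k
  ne_ki : k ≠ i

namespace IsLabelling

variable {i j k : Fin 3}

theorem succ (i : Fin 3) : IsLabelling i (i + 1) (i + 2) :=
  ⟨by fin_cases i <;> decide, by fin_cases i <;> decide, by fin_cases i <;> decide⟩

theorem rotate (h : IsLabelling i j k) : IsLabelling j k i := ⟨h.ne_jk, h.ne_ki, h.ne_ij⟩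

theorem swap (h : IsLabelling i j k) : IsLabelling i k j :=
  ⟨h.ne_ki.symm, h.ne_jk.symm, h.ne_ij.symm⟩

theorem eq_succ_or_swap (h : IsLabelling i j k) :
    (j = i + 1 ∧ k = i + 2) ∨ (j = i + 2 ∧ k = i + 1) := by
  obtain ⟨hij, hjk, hki⟩ := h
  revert i j k
  decide

theorem linearIndependent (h : IsLabelling i j k) {v : Fin 3 → Vec}
    (hv : LinearIndependent ℝ v) : LinearIndependent ℝ ![v i, v j, v k] := by
  have hinj : Function.Injective ![i, j, k] := by
    intro a b hab
    have := h.ne_ij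
    have := h.ne_jk
    have := h.ne_ki
    fin_cases a <;> fin_cases b <;> simp_all
  convert hv.comp _ hinj using 1
  ext a
  fin_cases a <;> rfl

theorem linearIndependent_pair (h : IsLabelling i j k) {v : Fin 3 → Vec}
    (hv : LinearIndependent ℝ v) : LinearIndependent ℝ ![v j, v k] :=
  (h.linearIndependent hv).comp Fin.succ (Fin.succ_injective 2)

theorem sum_eq (h : IsLabelling i j k) {M : Type*} [AddCommMonoid M] (f : Fin 3 → M) :
    ∑ l, f l = f i + f j + f k := by
  rw [Fin.sum_univ_three]
  obtain ⟨hij, hjk, hki⟩ := h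
  fin_cases i <;> fin_cases j <;> fin_cases k <;> simp_all <;> abel

end IsLabelling

theorem eq_of_smul_mem_hypPlane {u : Vec} {a b : ℝ} (ha : 0 ≤ a) (hb : 0 ≤ b)
    (hau : a • u ∈ hypPlane) (hbu : b • u ∈ hypPlane) : a = b := by
  have ha' := hau.1
  have hb' := hbu.1
  rw [mink_smul_left, mink_smul_right, ← mul_assoc, ← sq] at ha' hb'
  have hne : mink u u ≠ 0 := by
    intro h0
    simp [h0] at ha'
  exact (pow_left_inj₀ ha hb two_ne_zero).1 (mul_right_cancel₀ hne (ha'.trans hb'.symm))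

namespace GenTriangle

variable (T : GenTriangle) {i j k : Fin 3}

theorem type_cases (i : Fin 3) : T.type i = 1 ∨ T.type i = 0 ∨ T.type i = -1 := by
  grind [type]

theorem type_eq_one_iff : T.type i = 1 ↔ mink (T.v i) (T.v i) < 0 := by
  grind [type]

theorem type_eq_zero_iff : T.type i = 0 ↔ mink (T.v i) (T.v i) = 0 := by
  grind [type]

theorem type_eq_neg_one_iff : T.type i = -1 ↔ 0 < mink (T.v i) (T.v i) := by
  grind [type]

/-- The factor by which the homogeneous vector of a vertex exceeds the normalised one; at an ideal
vertex the normalisation puts the chosen horodisc at level `1/2`. -/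
def scale (i : Fin 3) : ℝ :=
  if mink (T.v i) (T.v i) = 0 then 2 * T.horo i else √|mink (T.v i) (T.v i)|

/-- The normalised vector of a vertex, with `⟨unit i, unit i⟩ = -ε_i`. -/
def unit (i : Fin 3) : Vec := (T.scale i)⁻¹ • T.v i

theorem scale_pos (i : Fin 3) : 0 < T.scale i := by
  rw [scale]
  split_ifs with h
  · exact mul_pos two_pos (T.horo_pos i h)
  · exact Real.sqrt_pos.2 (abs_pos.2 h)

theorem scale_smul_unit (i : Fin 3) : T.scale i • T.unit i = T.v i :=
  smul_inv_smul₀ (T.scale_pos i).ne' _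

theorem mink_unit_self (i : Fin 3) : mink (T.unit i) (T.unit i) = -T.type i := by
  rw [unit, mink_smul_left, mink_smul_right, ← mul_assoc, ← mul_inv]
  rcases lt_trichotomy (mink (T.v i) (T.v i)) 0 with h | h | h
  · rw [T.type_eq_one_iff.2 h, scale, if_neg h.ne, Real.mul_self_sqrt (abs_nonneg _),
      abs_of_neg h, inv_neg, neg_mul, inv_mul_cancel₀ h.ne]
  · rw [T.type_eq_zero_iff.2 h, h, mul_zero, neg_zero]
  · rw [T.type_eq_neg_one_iff.2 h, scale, if_neg h.ne', Real.mul_self_sqrt (abs_nonneg _),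
      abs_of_pos h, inv_mul_cancel₀ h.ne', neg_neg]

theorem unit_time_pos (h : mink (T.v i) (T.v i) ≤ 0) : 0 < T.unit i 0 :=
  mul_pos (inv_pos.2 (T.scale_pos i)) (T.future i h)

theorem unit_mem_hypPlane (h : T.type i = 1) : T.unit i ∈ hypPlane :=
  ⟨by rw [mink_unit_self, h], T.unit_time_pos (T.type_eq_one_iff.1 h).le⟩

theorem toHyp_v (h : T.type i = 1) : toHyp (T.v i) = T.unit i := by
  have h' := T.type_eq_one_iff.1 h
  rw [toHyp, unit, scale, if_neg h'.ne, abs_of_neg h']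

theorem linearIndependent_unit : LinearIndependent ℝ T.unit :=
  T.indep.units_smul fun i => Units.mk0 _ (inv_ne_zero (T.scale_pos i).ne')

theorem mink_unit_right (x : Vec) (i : Fin 3) :
    mink x (T.unit i) = mink x (T.v i) / T.scale i := by
  rw [unit, mink_smul_right, inv_mul_eq_div]

theorem body_eq_unitBody (i : Fin 3) : T.body i = unitBody (T.unit i) := by
  rcases lt_trichotomy (mink (T.v i) (T.v i)) 0 with h | h | h
  · have h1 := T.type_eq_one_iff.2 h
    rw [body, if_pos h, T.toHyp_v h1, unitBody_eq_singleton (T.unit_mem_hypPlane h1)]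
  · have hs : T.scale i = 2 * T.horo i := if_pos h
    have hlevel (x : Vec) : -mink x (T.unit i) ≤ 1 / 2 ↔ -mink x (T.v i) ≤ T.horo i := by
      rw [mink_unit_right, ← neg_div, div_le_iff₀ (T.scale_pos i), hs]
      ring_nf
    simp only [body, unitBody, if_neg h.not_lt, if_pos h, mink_unit_self, T.type_eq_zero_iff.2 h,
      neg_zero, sub_zero, hlevel]
  · have hlevel (x : Vec) : -mink x (T.unit i) ≤ 0 ↔ 0 ≤ mink x (T.v i) := by
      rw [mink_unit_right, neg_nonpos, le_div_iff₀ (T.scale_pos i), zero_mul]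
    simp only [body, unitBody, if_neg h.not_gt, if_neg h.ne', mink_unit_self,
      T.type_eq_neg_one_iff.2 h, neg_neg, sub_self, zero_div, hlevel]

theorem bodyBoundary_eq_unitBodyBoundary (i : Fin 3) :
    T.bodyBoundary i = unitBodyBoundary (T.unit i) := by
  rcases lt_trichotomy (mink (T.v i) (T.v i)) 0 with h | h | h
  · have h1 := T.type_eq_one_iff.2 h
    rw [bodyBoundary, if_pos h, T.toHyp_v h1,
      unitBodyBoundary_eq_singleton (T.unit_mem_hypPlane h1)]
  · have hs : T.scale i = 2 * T.horo i := if_pos h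
    have hlevel (x : Vec) : -mink x (T.unit i) = 1 / 2 ↔ -mink x (T.v i) = T.horo i := by
      rw [mink_unit_right, ← neg_div, div_eq_iff (T.scale_pos i).ne', hs]
      ring_nf
    simp only [bodyBoundary, unitBodyBoundary, if_neg h.not_lt, if_pos h, mink_unit_self,
      T.type_eq_zero_iff.2 h, neg_zero, sub_zero, hlevel]
  · have hlevel (x : Vec) : -mink x (T.unit i) = 0 ↔ mink x (T.v i) = 0 := by
      rw [mink_unit_right, neg_eq_zero, div_eq_zero_iff, or_iff_left (T.scale_pos i).ne']
    simp only [bodyBoundary, unitBodyBoundary, if_neg h.not_gt, if_neg h.ne', mink_unit_self,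
      T.type_eq_neg_one_iff.2 h, neg_neg, sub_self, zero_div, hlevel]

theorem sideLine_eq_geodesic (h : IsLabelling i j k) :
    sideLine T.v i = geodesic (T.unit j) (T.unit k) := by
  have hsucc : sideLine T.v i = geodesic (T.v (i + 1)) (T.v (i + 2)) := by
    simp only [sideLine, geodesic, Submodule.mem_span_pair, eq_comm]
  have hunit (l : Fin 3) : IsUnit (T.scale l)⁻¹ := IsUnit.mk0 _ (inv_ne_zero (T.scale_pos l).ne')
  have hspan : geodesic (T.unit j) (T.unit k) = geodesic (T.v j) (T.v k) := by
    simp only [geodesic, unit, Submodule.span_insert, Submodule.span_singleton_smul_eq (hunit _)]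
  rw [hspan, hsucc]
  rcases h.eq_succ_or_swap with ⟨rfl, rfl⟩ | ⟨rfl, rfl⟩
  · rfl
  · exact geodesic_comm _ _

theorem length_eq_segmentLength (i : Fin 3) :
    T.length i = segmentLength (T.unit (i + 1)) (T.unit (i + 2)) := by
  simp only [length, segmentLength, body_eq_unitBody, bodyBoundary_eq_unitBodyBoundary,
    T.sideLine_eq_geodesic (.succ i)]

/-! ### Edges -/

theorem exists_nonneg_of_mem_edge (h : IsLabelling i j k) {x : Vec}
    (hx : x ∈ sideLine T.v i ∩ polygon T.v) :
    ∃ a b : ℝ, 0 ≤ a ∧ 0 ≤ b ∧ x = a • T.unit j + b • T.unit k := by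
  obtain ⟨hline, -, ⟨c, hc, hxc⟩, -⟩ := hx
  rw [T.sideLine_eq_geodesic h] at hline
  obtain ⟨a, b, hab⟩ := Submodule.mem_span_pair.1 hline.2
  have hci : c i = 0 := by
    have hrel : ∑ l, ![c i * T.scale i, c j * T.scale j - a, c k * T.scale k - b] l •
        ![T.unit i, T.unit j, T.unit k] l = 0 := by
      simp only [h.sum_eq, ← T.scale_smul_unit] at hxc
      simp only [Fin.sum_univ_three, Matrix.cons_val]
      linear_combination (norm := module) -hxc - hab
    have := Fintype.linearIndependent_iff.1 (h.linearIndependent T.linearIndependent_unit) _ hrel 0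
    simpa [(T.scale_pos i).ne'] using this
  refine ⟨c j * T.scale j, c k * T.scale k, mul_nonneg (hc j) (T.scale_pos j).le,
    mul_nonneg (hc k) (T.scale_pos k).le, ?_⟩
  rw [hxc, h.sum_eq, hci, ← T.scale_smul_unit j, ← T.scale_smul_unit k]
  module

theorem exists_edge_point (h : IsLabelling i j k) :
    ∃ a b : ℝ, 0 < a ∧ 0 ≤ b ∧ a • T.unit j + b • T.unit k ∈ hypPlane ∧
      (T.type j = -1 → mink (a • T.unit j + b • T.unit k) (T.unit j) ≤ 0) := by
  obtain ⟨x, hx, y, hy, hxy⟩ := T.edge_nontrivial i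
  have hpolar {z : Vec} (hz : z ∈ polygon T.v) (hj : T.type j = -1) :
      mink z (T.unit j) ≤ 0 := by
    rw [mink_unit_right]
    exact div_nonpos_of_nonpos_of_nonneg (hz.2.2 j (T.type_eq_neg_one_iff.1 hj))
      (T.scale_pos j).le
  obtain ⟨a, b, ha, hb, rfl⟩ := T.exists_nonneg_of_mem_edge h hx
  obtain ⟨c, d, hc, hd, rfl⟩ := T.exists_nonneg_of_mem_edge h hy
  rcases ha.lt_or_eq with ha | rfl
  · exact ⟨a, b, ha, hb, hx.1.1, hpolar hx.2⟩
  rcases hc.lt_or_eq with hc | rfl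
  · exact ⟨c, d, hc, hd, hy.1.1, hpolar hy.2⟩
  have hxH := hx.1.1
  have hyH := hy.1.1
  rw [zero_smul, zero_add] at hxH hyH
  exact absurd (by rw [eq_of_smul_mem_hypPlane hb hd hxH hyH]) hxy

/-! ### The Gram matrix of a triangle -/

/-- The entry `-⟨unit j, unit k⟩` of the Gram matrix, which turns out to be `τ'(l_i)`. -/
def gram (i : Fin 3) : ℝ := -mink (T.unit (i + 1)) (T.unit (i + 2))

/-- The square root of a principal minor of the Gram matrix, which turns out to be `τ(l_i)`. -/
def minor (i : Fin 3) : ℝ := √(T.gram i ^ 2 - T.type (i + 1) * T.type (i + 2))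

/-- The square root of the Gram determinant: the volume spanned by the normalised vertices. -/
def volume : ℝ := |(Matrix.of T.unit).det|

theorem mink_unit_unit (h : IsLabelling i j k) : mink (T.unit j) (T.unit k) = -T.gram i := by
  rw [gram, neg_neg]
  rcases h.eq_succ_or_swap with ⟨rfl, rfl⟩ | ⟨rfl, rfl⟩
  · rfl
  · exact mink_comm _ _

theorem minor_eq_sqrt (h : IsLabelling i j k) :
    T.minor i = √(T.gram i ^ 2 - T.type j * T.type k) := by
  rw [minor]
  rcases h.eq_succ_or_swap with ⟨rfl, rfl⟩ | ⟨rfl, rfl⟩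
  · rfl
  · rw [mul_comm]

theorem type_mul_type_lt_gram_sq (h : IsLabelling i j k) :
    T.type j * T.type k < T.gram i ^ 2 := by
  obtain ⟨a, b, -, -, hx, -⟩ := T.exists_edge_point h
  have := mink_self_mul_mink_self_lt_sq (h.linearIndependent_pair T.linearIndependent_unit)
    (by linarith [hx.1])
  rwa [mink_unit_self, mink_unit_self, T.mink_unit_unit h, neg_mul_neg, neg_sq] at this

theorem minor_pos (i : Fin 3) : 0 < T.minor i :=
  Real.sqrt_pos.2 (sub_pos.2 (T.type_mul_type_lt_gram_sq (.succ i)))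

theorem minor_sq (h : IsLabelling i j k) :
    T.minor i ^ 2 = T.gram i ^ 2 - T.type j * T.type k := by
  rw [T.minor_eq_sqrt h, Real.sq_sqrt (sub_nonneg.2 (T.type_mul_type_lt_gram_sq h).le)]

theorem gram_pos_of_type_eq_neg_one (h : IsLabelling i j k) (hj : T.type j = -1) :
    0 < T.gram i := by
  obtain ⟨a, b, ha, hb, -, hpolar⟩ := T.exists_edge_point h
  have := hpolar hj
  rw [mink_add_left, mink_smul_left, mink_smul_left, mink_unit_self, mink_comm,
    T.mink_unit_unit h, hj] at this
  exact pos_of_mul_pos_right (by linarith) hb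

theorem gram_pos (i : Fin 3) : 0 < T.gram i := by
  have h := IsLabelling.succ i
  by_cases hj : T.type (i + 1) = -1
  · exact T.gram_pos_of_type_eq_neg_one h hj
  by_cases hk : T.type (i + 2) = -1
  · exact T.gram_pos_of_type_eq_neg_one h.swap hk
  have hcausal {l : Fin 3} (hl : T.type l ≠ -1) :
      mink (T.unit l) (T.unit l) ≤ 0 ∧ 0 ≤ T.unit l 0 := by
    rw [Ne, type_eq_neg_one_iff, not_lt] at hl
    refine ⟨?_, (T.unit_time_pos hl).le⟩
    rw [mink_unit_self]
    grind [T.type_cases l, T.type_eq_neg_one_iff (i := l)]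
  have hnonneg : 0 ≤ T.gram i :=
    neg_nonneg.2 (mink_nonpos_of_causal (hcausal hj).1 (hcausal hj).2 (hcausal hk).1
      (hcausal hk).2)
  have hsq : 0 < T.gram i ^ 2 := by
    refine lt_of_le_of_lt (mul_nonneg ?_ ?_) (T.type_mul_type_lt_gram_sq h)
    · grind [T.type_cases (i + 1)]
    · grind [T.type_cases (i + 2)]
  exact hnonneg.lt_of_ne' (pow_ne_zero_iff two_ne_zero |>.1 hsq.ne')

theorem volume_pos : 0 < T.volume := by
  have hrows : LinearIndependent ℝ (Matrix.of T.unit).row := T.linearIndependent_unit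
  exact abs_pos.2 (Matrix.isUnit_iff_isUnit_det _ |>.1
    (Matrix.linearIndependent_rows_iff_isUnit.1 hrows)).ne_zero

theorem volume_sq (h : IsLabelling i j k) :
    T.volume ^ 2 = T.type i * T.type j * T.type k + 2 * T.gram i * T.gram j * T.gram k -
      T.type i * T.gram i ^ 2 - T.type j * T.gram j ^ 2 - T.type k * T.gram k ^ 2 := by
  have hdet : T.volume ^ 2 = -(Matrix.of fun a b => mink (T.unit a) (T.unit b)).det := by
    rw [det_gram, neg_neg, volume, sq_abs, sq]
  have h₀ : IsLabelling 0 1 2 := .succ 0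
  rw [hdet, Matrix.det_fin_three]
  simp only [Matrix.of_apply, mink_unit_self, T.mink_unit_unit h₀, T.mink_unit_unit h₀.swap,
    T.mink_unit_unit h₀.rotate, T.mink_unit_unit h₀.rotate.swap,
    T.mink_unit_unit h₀.rotate.rotate, T.mink_unit_unit h₀.rotate.rotate.swap]
  have hsucc (i : Fin 3) : i = 0 ∨ i = 1 ∨ i = 2 := by fin_cases i <;> simp
  rcases h.eq_succ_or_swap with ⟨rfl, rfl⟩ | ⟨rfl, rfl⟩ <;>
    rcases hsucc i with rfl | rfl | rfl <;> simp only [Fin.isValue, Fin.reduceAdd] <;> ring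

end GenTriangle

/-! ### Edge lengths -/

namespace GenTriangle

variable (T : GenTriangle) {i j k : Fin 3}

theorem length_eq (i : Fin 3) : T.length i = Real.log (T.gram i + T.minor i) := by
  have h := IsLabelling.succ i
  obtain ⟨a, b, ha, hb, hx, -⟩ := T.exists_edge_point h
  have hgram := T.mink_unit_unit h
  have hlog := segmentLength_eq_log (T.mink_unit_self _) (T.mink_unit_self _)
    (T.type_cases _) (T.type_cases _) (hgram.trans_lt (neg_neg_of_pos (T.gram_pos i)))
    (by rw [hgram, neg_sq]; exact T.type_mul_type_lt_gram_sq h) ha.le hb hx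
  rw [length_eq_segmentLength, hlog, hgram, neg_neg, minor]

theorem tau_length (h : IsLabelling i j k) :
    tau (T.type j * T.type k) (T.length i) = T.minor i := by
  rw [length_eq, T.minor_eq_sqrt h,
    tau_log_add_sqrt (T.gram_pos i) (T.type_mul_type_lt_gram_sq h).le]

theorem tau'_length (h : IsLabelling i j k) :
    tau' (T.type j * T.type k) (T.length i) = T.gram i := by
  rw [length_eq, T.minor_eq_sqrt h,
    tau'_log_add_sqrt (T.gram_pos i) (T.type_mul_type_lt_gram_sq h).le]

theorem exp_length (i : Fin 3) : Real.exp (T.length i) = T.gram i + T.minor i := by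
  rw [length_eq, Real.exp_log (add_pos (T.gram_pos i) (T.minor_pos i))]

theorem type_mul_type_mul_exp_neg_length (h : IsLabelling i j k) :
    T.type j * T.type k * Real.exp (-T.length i) = T.gram i - T.minor i := by
  rw [length_eq, T.minor_eq_sqrt h,
    mul_exp_neg_log_add_sqrt (T.gram_pos i) (T.type_mul_type_lt_gram_sq h).le]

end GenTriangle

/-! ### Angles at points of the hyperbolic plane -/

theorem tangentPart_smul (p x : Vec) (a : ℝ) : tangentPart p (a • x) = a • tangentPart p x := by
  rw [tangentPart, tangentPart, mink_smul_left, smul_add, smul_smul]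

theorem mink_tangentPart {p : Vec} (hp : mink p p = -1) (x y : Vec) :
    mink (tangentPart p x) (tangentPart p y) = mink x y + mink x p * mink y p := by
  simp only [tangentPart, mink_add_left, mink_add_right, mink_smul_left, mink_smul_right, hp,
    mink_comm p y]
  ring

theorem sqrt_mink_smul_self (a : ℝ) (x : Vec) :
    √(mink (a • x) (a • x)) = |a| * √(mink x x) := by
  rw [mink_smul_left, mink_smul_right, ← mul_assoc, ← sq, Real.sqrt_mul (sq_nonneg a),
    Real.sqrt_sq_eq_abs]

theorem hypAngle_smul_smul {a b : ℝ} (ha : 0 < a) (hb : 0 < b) (p x y : Vec) :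
    hypAngle p (a • x) (b • y) = hypAngle p x y := by
  simp only [hypAngle, tangentPart_smul, sqrt_mink_smul_self, abs_of_pos ha, abs_of_pos hb]
  rw [mink_smul_left, mink_smul_right, ← mul_assoc, mul_mul_mul_comm a,
    mul_div_mul_left _ _ (mul_pos ha hb).ne']

/-! ### Common perpendiculars -/

/-- The point of `ℍ²` where the polar geodesic of the spacelike unit vector `u` meets the geodesic
spanned by `u` and `x`. -/
def perpendicularFoot (u x : Vec) : Vec := toHyp (x - mink x u • u)

section PerpendicularFoot

variable {u x y : Vec}

theorem mink_sub_smul_sub_smul (hu : mink u u = 1) (x y : Vec) :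
    mink (x - mink x u • u) (y - mink y u • u) = mink x y - mink x u * mink y u := by
  simp only [mink_sub_left, mink_sub_right, mink_smul_left, mink_smul_right, hu, mink_comm u y]
  ring

theorem mink_perpendicularFoot_self (hu : mink u u = 1) (x : Vec) :
    mink u (perpendicularFoot u x) = 0 := by
  have hperp : mink u (x - mink x u • u) = 0 := by
    rw [mink_sub_right, mink_smul_right, hu, mul_one, mink_comm, sub_self]
  rw [perpendicularFoot, toHyp, mink_smul_right, hperp, mul_zero]

theorem mink_perpendicularFoot_perpendicularFoot (hu : mink u u = 1) (x y : Vec) :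
    mink (perpendicularFoot u x) (perpendicularFoot u y) = (mink x y - mink x u * mink y u) /
      (√(mink x u ^ 2 - mink x x) * √(mink y u ^ 2 - mink y y)) := by
  simp only [perpendicularFoot, toHyp, mink_smul_left, mink_smul_right, mink_sub_smul_sub_smul hu,
    neg_sub, ← sq]
  rw [div_eq_inv_mul, mul_inv, mul_assoc, mul_left_comm]

theorem perpendicularFoot_mem_hypPlane {a b : ℝ} (hu : mink u u = 1)
    (hx : mink x x < mink x u ^ 2) (ha : 0 < a) (hz : a • x + b • u ∈ hypPlane) :
    perpendicularFoot u x ∈ hypPlane := by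
  have hneg : mink (x - mink x u • u) (x - mink x u • u) < 0 := by
    rw [mink_sub_smul_sub_smul hu]
    linarith
  refine toHyp_mem_hypPlane hneg
    (time_pos_of_mink_neg (by linarith [hz.1]) hz.2.le hneg.le ?_)
  have hdecomp : mink (a • x + b • u) (x - mink x u • u) = a * (mink x x - mink x u ^ 2) := by
    simp only [mink_add_left, mink_sub_right, mink_smul_left, mink_smul_right, hu, mink_comm u x]
    ring
  rw [hdecomp]
  exact mul_neg_of_pos_of_neg ha (sub_neg.2 hx)

theorem geodesic_perpendicularFoot (hu : mink u u = 1) (hx : mink x x < mink x u ^ 2) :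
    geodesic u (perpendicularFoot u x) = geodesic u x := by
  have hs : 0 < √(-mink (x - mink x u • u) (x - mink x u • u)) := by
    rw [mink_sub_smul_sub_smul hu]
    exact Real.sqrt_pos.2 (by linarith)
  rw [perpendicularFoot, toHyp]
  apply subset_antisymm <;> apply geodesic_subset_geodesic
  · exact Submodule.mem_span_pair.2 ⟨1, 0, by module⟩
  · exact Submodule.smul_mem _ _ (Submodule.mem_span_pair.2 ⟨-mink x u, 1, by module⟩)
  · exact Submodule.mem_span_pair.2 ⟨1, 0, by module⟩
  · refine Submodule.mem_span_pair.2
      ⟨mink x u, √(-mink (x - mink x u • u) (x - mink x u • u)), ?_⟩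
    rw [smul_inv_smul₀ hs.ne', add_sub_cancel]

theorem setDist_geodesic_geodesic {a b c d : ℝ} (hu : mink u u = 1)
    (hx : mink x x < mink x u ^ 2) (hy : mink y y < mink y u ^ 2) (ha : 0 < a) (hc : 0 < c)
    (hax : a • x + b • u ∈ hypPlane) (hcy : c • y + d • u ∈ hypPlane) :
    0 ≤ setDist (geodesic u x) (geodesic u y) ∧
      Real.cosh (setDist (geodesic u x) (geodesic u y)) = (mink x u * mink y u - mink x y) /
        (√(mink x u ^ 2 - mink x x) * √(mink y u ^ 2 - mink y y)) := by
  have hP := perpendicularFoot_mem_hypPlane hu hx ha hax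
  have hQ := perpendicularFoot_mem_hypPlane hu hy hc hcy
  rw [← geodesic_perpendicularFoot hu hx, ← geodesic_perpendicularFoot hu hy,
    setDist_geodesic_eq_of_perpendicular hP hQ (mink_perpendicularFoot_self hu x)
      (mink_perpendicularFoot_self hu y)]
  refine ⟨hypDist_nonneg hP hQ, ?_⟩
  rw [cosh_hypDist hP hQ, mink_perpendicularFoot_perpendicularFoot hu, ← neg_div, neg_sub]

end PerpendicularFoot

/-! ### Arc length -/

theorem contDiff_mink_const (w : Vec) : ContDiff ℝ 1 fun x => mink x w := by
  unfold mink
  fun_prop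

section ArcLength

variable {γ δ : ℝ → Vec}

theorem continuous_sqrt_mink_deriv (hδ : ContDiff ℝ 1 δ) :
    Continuous fun t => √(mink (deriv δ t) (deriv δ t)) := by
  have := hδ.continuous_deriv le_rfl
  unfold mink
  fun_prop

theorem curveLength_eq_of_eqOn_comp {σ : ℝ → ℝ} (hδ : ContDiff ℝ 1 δ) (hσ : ContDiff ℝ 1 σ)
    (hγ : Set.EqOn γ (δ ∘ σ) (Set.Icc 0 1)) :
    curveLength γ = ∫ t in (0 : ℝ)..1,
      |deriv σ t| * √(mink (deriv δ (σ t)) (deriv δ (σ t))) := by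
  refine intervalIntegral.integral_congr_Ioo_of_le zero_le_one fun t ht => ?_
  have hnhds : γ =ᶠ[nhds t] δ ∘ σ :=
    Filter.eventually_of_mem (Ioo_mem_nhds ht.1 ht.2) fun s hs => hγ (Set.Ioo_subset_Icc_self hs)
  have hchain : deriv γ t = deriv σ t • deriv δ (σ t) := by
    rw [hnhds.deriv_eq]
    exact deriv.scomp t (hδ.differentiable one_ne_zero _) (hσ.differentiable one_ne_zero _)
  simp only [hchain, sqrt_mink_smul_self]

theorem integral_le_integral_abs_deriv_mul_comp {f σ : ℝ → ℝ} {t₀ t₁ : ℝ} (hf : Continuous f)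
    (hf0 : ∀ s, 0 ≤ f s) (hσ : ContDiff ℝ 1 σ) (ht₀ : t₀ ∈ Set.Icc (0 : ℝ) 1)
    (ht₁ : t₁ ∈ Set.Icc (0 : ℝ) 1) :
    ∫ s in σ t₀..σ t₁, f s ≤ ∫ t in (0 : ℝ)..1, |deriv σ t| * f (σ t) := by
  have hσ' : Continuous (deriv σ) := hσ.continuous_deriv le_rfl
  have hcont : Continuous fun t => |deriv σ t| * f (σ t) :=
    hσ'.abs.mul (hf.comp hσ.continuous)
  have hnonneg (t : ℝ) : 0 ≤ |deriv σ t| * f (σ t) := mul_nonneg (abs_nonneg _) (hf0 _)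
  have hnorm (t : ℝ) : |deriv σ t| * f (σ t) = ‖(f ∘ σ) t * deriv σ t‖ := by
    rw [norm_mul, mul_comm, Function.comp_apply, Real.norm_of_nonneg (hf0 _), Real.norm_eq_abs]
  have hsub : Set.uIoc t₀ t₁ ⊆ Set.uIoc 0 1 := by
    rw [Set.uIoc_of_le zero_le_one]
    exact Set.Ioc_subset_Ioc (le_min ht₀.1 ht₁.1) (max_le ht₀.2 ht₁.2)
  calc ∫ s in σ t₀..σ t₁, f s
      = ∫ t in t₀..t₁, (f ∘ σ) t * deriv σ t :=
        (intervalIntegral.integral_comp_mul_deriv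
          (fun t _ => (hσ.differentiable one_ne_zero t).hasDerivAt) hσ'.continuousOn hf).symm
    _ ≤ |∫ t in t₀..t₁, |deriv σ t| * f (σ t)| := by
        simp only [hnorm]
        exact (Real.le_norm_self _).trans intervalIntegral.norm_integral_le_abs_integral_norm
    _ ≤ |∫ t in (0 : ℝ)..1, |deriv σ t| * f (σ t)| :=
        intervalIntegral.abs_integral_mono_interval hsub (.of_forall hnonneg)
          (hcont.intervalIntegrable 0 1)
    _ = ∫ t in (0 : ℝ)..1, |deriv σ t| * f (σ t) :=
        abs_of_nonneg (intervalIntegral.integral_nonneg zero_le_one fun t _ => hnonneg t)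

theorem arcLength_image_eq_curveLength {φ : Vec → ℝ} (hδ : ContDiff ℝ 1 δ) (hφ : ContDiff ℝ 1 φ)
    (hφδ : Function.LeftInverse φ δ) : arcLength (δ '' Set.Icc 0 1) = curveLength δ := by
  refine IsLeast.csInf_eq ⟨⟨δ, hδ, hφδ.injective.injOn, rfl, rfl⟩, ?_⟩
  rintro L ⟨γ, hγ, -, himage, rfl⟩
  have hσ : ContDiff ℝ 1 (φ ∘ γ) := hφ.comp hγ
  have hγδ : Set.EqOn γ (δ ∘ φ ∘ γ) (Set.Icc 0 1) := by
    intro t ht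
    obtain ⟨s, -, hs⟩ : γ t ∈ δ '' Set.Icc 0 1 := himage ▸ Set.mem_image_of_mem γ ht
    simp only [Function.comp_apply, ← hs, hφδ s]
  have hsurj {s : ℝ} (hs : s ∈ Set.Icc (0 : ℝ) 1) : ∃ t ∈ Set.Icc (0 : ℝ) 1, (φ ∘ γ) t = s := by
    obtain ⟨t, ht, hts⟩ : δ s ∈ γ '' Set.Icc 0 1 := himage ▸ Set.mem_image_of_mem δ hs
    exact ⟨t, ht, by rw [Function.comp_apply, hts, hφδ s]⟩
  obtain ⟨t₀, ht₀, h₀⟩ := hsurj (Set.left_mem_Icc.2 zero_le_one)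
  obtain ⟨t₁, ht₁, h₁⟩ := hsurj (Set.right_mem_Icc.2 zero_le_one)
  have hle := integral_le_integral_abs_deriv_mul_comp (continuous_sqrt_mink_deriv hδ)
    (fun _ => Real.sqrt_nonneg _) hσ ht₀ ht₁
  rwa [h₀, h₁, ← curveLength_eq_of_eqOn_comp hδ hσ hγδ] at hle

end ArcLength

/-! ### Horocycles -/

/-- The point `y + r • n` of the horocycle `⟨x, n⟩ = -1/2` of the null vector `n` above a vector
`y` of the affine plane `⟨y, n⟩ = -1/2`. -/
def horocyclePoint (n y : Vec) : Vec := y + (1 + mink y y) • n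

/-- The wedge with apex `n` that is bounded by the geodesics from `n` through `u` and `w`. -/
def wedge (n u w : Vec) : Set Vec :=
  {x | x ∈ hypPlane ∧ ∃ a b c : ℝ, 0 ≤ b ∧ 0 ≤ c ∧ x = a • n + b • u + c • w}

theorem wedge_smul {n u w : Vec} {a b c : ℝ} (ha : a ≠ 0) (hb : 0 < b) (hc : 0 < c) :
    wedge (a • n) (b • u) (c • w) = wedge n u w := by
  ext x
  refine and_congr_right fun _ => ⟨?_, ?_⟩
  · rintro ⟨a', b', c', hb', hc', rfl⟩
    exact ⟨a' * a, b' * b, c' * c, mul_nonneg hb' hb.le, mul_nonneg hc' hc.le, by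
      simp only [mul_smul]⟩
  · rintro ⟨a', b', c', hb', hc', rfl⟩
    exact ⟨a' / a, b' / b, c' / c, div_nonneg hb' hb.le, div_nonneg hc' hc.le, by
      simp only [smul_smul, div_mul_cancel₀ _ ha, div_mul_cancel₀ _ hb.ne',
        div_mul_cancel₀ _ hc.ne']⟩

section Horocycle

variable {n u w : Vec}

theorem mink_horocyclePoint_self {y : Vec} (hn : mink n n = 0) (hy : mink y n = -1 / 2) :
    mink (horocyclePoint n y) (horocyclePoint n y) = -1 := by
  rw [horocyclePoint, mink_self_add, mink_smul_left, mink_smul_right, mink_smul_right, hn, hy]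
  ring

theorem horocycle_inter_wedge (hn : mink n n = 0) (hn0 : 0 < n 0) (hu : mink u n = -1 / 2)
    (hw : mink w n = -1 / 2) :
    {x | x ∈ hypPlane ∧ -mink x n = 1 / 2} ∩ wedge n u w =
      horocyclePoint n '' segment ℝ u w := by
  ext x
  constructor
  · rintro ⟨⟨hx, hxn⟩, -, a, b, c, hb, hc, hxabc⟩
    have hbc : b + c = 1 := by
      rw [hxabc, mink_add_left, mink_add_left, mink_smul_left, mink_smul_left, mink_smul_left, hn,
        hu, hw] at hxn
      linarith
    refine ⟨b • u + c • w, ⟨b, c, hb, hc, hbc, rfl⟩, ?_⟩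
    have hy : mink (b • u + c • w) n = -1 / 2 := by
      rw [mink_add_left, mink_smul_left, mink_smul_left, hu, hw]
      linear_combination -hbc / 2
    have ha : a = 1 + mink (b • u + c • w) (b • u + c • w) := by
      have hxx := hx.1
      rw [hxabc, add_assoc, add_comm, mink_self_add, mink_smul_left, mink_smul_right,
        mink_smul_right, hn, hy] at hxx
      linarith
    rw [horocyclePoint, ← ha, hxabc]
    module
  · rintro ⟨-, ⟨b, c, hb, hc, hbc, rfl⟩, rfl⟩
    have hy : mink (b • u + c • w) n = -1 / 2 := by
      rw [mink_add_left, mink_smul_left, mink_smul_left, hu, hw]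
      linear_combination -hbc / 2
    have hxn : mink (horocyclePoint n (b • u + c • w)) n = -1 / 2 := by
      rw [horocyclePoint, mink_add_left, mink_smul_left, hn, hy, mul_zero, add_zero]
    have hx : horocyclePoint n (b • u + c • w) ∈ hypPlane := by
      have hxx := mink_horocyclePoint_self hn hy
      refine ⟨hxx, time_pos_of_mink_neg hn.le hn0.le (by linarith) ?_⟩
      rw [mink_comm, hxn]
      norm_num
    exact ⟨⟨hx, by rw [hxn]; norm_num⟩, hx, _, b, c, hb, hc, by
      rw [horocyclePoint, add_comm, add_assoc]⟩

theorem arcLength_horocyclePoint_segment (hn : mink n n = 0) (hu : mink u n = -1 / 2)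
    (hw : mink w n = -1 / 2) (huw : mink (w - u) (w - u) ≠ 0) :
    arcLength (horocyclePoint n '' segment ℝ u w) = √(mink (w - u) (w - u)) := by
  obtain ⟨z, hz⟩ : ∃ z, z = w - u := ⟨_, rfl⟩
  rw [← hz] at huw ⊢
  have hzn : mink z n = 0 := by rw [hz, mink_sub_left, hu, hw, sub_self]
  obtain ⟨δ, hδ⟩ : ∃ δ : ℝ → Vec, δ = fun s => horocyclePoint n (u + s • z) := ⟨_, rfl⟩
  have himage : horocyclePoint n '' segment ℝ u w = δ '' Set.Icc 0 1 := by
    rw [segment_eq_image', ← hz, Set.image_image, hδ]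
  have hderiv (s : ℝ) : ∃ r : ℝ, deriv δ s = z + r • n := by
    have hcoeff : Differentiable ℝ fun s : ℝ => 1 + mink (u + s • z) (u + s • z) := by
      unfold mink
      fun_prop
    have := (((hasDerivAt_id' s).smul_const z).const_add u).add
      ((hcoeff s).hasDerivAt.smul_const n)
    rw [one_smul] at this
    exact ⟨_, by rw [hδ]; exact this.deriv⟩
  have hspeed (s : ℝ) : mink (deriv δ s) (deriv δ s) = mink z z := by
    obtain ⟨r, hr⟩ := hderiv s
    rw [hr, mink_self_add, mink_smul_left, mink_smul_right, mink_smul_right, hn, hzn]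
    ring
  have hleft : Function.LeftInverse (fun x => (mink x z - mink u z) / mink z z) δ := by
    intro s
    simp only [hδ, horocyclePoint, mink_add_left, mink_smul_left, mink_comm n z, hzn, mul_zero,
      add_zero, add_sub_cancel_left]
    exact mul_div_cancel_right₀ s huw
  have hsmooth : ContDiff ℝ 1 δ := by
    simp only [hδ, horocyclePoint, mink]
    fun_prop
  rw [himage, arcLength_image_eq_curveLength hsmooth
    (((contDiff_mink_const z).sub contDiff_const).div_const _) hleft, curveLength]
  simp only [hspeed, intervalIntegral.integral_const, sub_zero, one_smul]

end Horocycle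

/-! ### Generalized angles -/

namespace GenTriangle

variable (T : GenTriangle) {i j k : Fin 3}

theorem angle_of_type_eq_one (h : IsLabelling i j k) (hi : T.type i = 1) :
    T.angle i =
      Real.arccos ((T.gram j * T.gram k - T.gram i) / (T.minor j * T.minor k)) := by
  wlog hs : j = i + 1 ∧ k = i + 2 generalizing j k
  · rw [mul_comm (T.gram j), mul_comm (T.minor j)]
    exact this h.swap (h.eq_succ_or_swap.resolve_left hs).symm
  have hself : mink (T.unit i) (T.unit i) = -1 := by rw [mink_unit_self, hi]
  rw [T.minor_eq_sqrt h.rotate, T.minor_eq_sqrt h.rotate.rotate, angle,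
    if_pos (T.type_eq_one_iff.1 hi), T.toHyp_v hi, ← hs.1, ← hs.2, ← T.scale_smul_unit j,
    ← T.scale_smul_unit k, hypAngle_smul_smul (T.scale_pos j) (T.scale_pos k), hypAngle]
  simp only [mink_tangentPart hself, mink_unit_self, T.mink_unit_unit h,
    T.mink_unit_unit h.rotate, T.mink_unit_unit h.rotate.rotate.swap, hi]
  ring_nf

theorem angle_of_type_eq_neg_one (h : IsLabelling i j k) (hi : T.type i = -1) :
    0 ≤ T.angle i ∧ Real.cosh (T.angle i) =
      (T.gram j * T.gram k + T.gram i) / (T.minor j * T.minor k) := by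
  wlog hs : j = i + 1 ∧ k = i + 2 generalizing j k
  · rw [mul_comm (T.gram j), mul_comm (T.minor j)]
    exact this h.swap (h.eq_succ_or_swap.resolve_left hs).symm
  have hv := T.type_eq_neg_one_iff.1 hi
  have hangle : T.angle i =
      setDist (geodesic (T.unit i) (T.unit k)) (geodesic (T.unit i) (T.unit j)) := by
    rw [angle, if_neg hv.not_gt, if_neg hv.ne', ← hs.1, ← hs.2,
      T.sideLine_eq_geodesic h.rotate.swap, T.sideLine_eq_geodesic h.rotate.rotate]
  have hj := T.type_mul_type_lt_gram_sq h.rotate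
  have hk := T.type_mul_type_lt_gram_sq h.rotate.rotate
  obtain ⟨a, b, ha, -, hab, -⟩ := T.exists_edge_point h.rotate
  obtain ⟨c, d, hc, -, hcd, -⟩ := T.exists_edge_point h.rotate.rotate.swap
  have hdist := setDist_geodesic_geodesic (u := T.unit i) (x := T.unit k) (y := T.unit j)
    (by rw [mink_unit_self, hi, neg_neg])
    (by rw [mink_unit_self, T.mink_unit_unit h.rotate]; linear_combination hj - T.type k * hi)
    (by
      rw [mink_unit_self, T.mink_unit_unit h.rotate.rotate.swap]
      linear_combination hk - T.type j * hi)
    ha hc hab hcd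
  rw [hangle, T.minor_eq_sqrt h.rotate, T.minor_eq_sqrt h.rotate.rotate]
  refine ⟨hdist.1, hdist.2.trans ?_⟩
  rw [mink_unit_self, mink_unit_self, T.mink_unit_unit h.rotate,
    T.mink_unit_unit h.rotate.rotate.swap, T.mink_unit_unit h.swap, hi]
  ring_nf

theorem sector_eq_wedge (i : Fin 3) {b c : ℝ} (hb : 0 < b) (hc : 0 < c) :
    T.sector i = wedge (T.unit i) (b • T.unit (i + 1)) (c • T.unit (i + 2)) := by
  have hunit : wedge (T.v i) (T.v (i + 1)) (T.v (i + 2)) =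
      wedge (T.unit i) (T.unit (i + 1)) (T.unit (i + 2)) :=
    (wedge_smul (inv_ne_zero (T.scale_pos i).ne') (inv_pos.2 (T.scale_pos _))
      (inv_pos.2 (T.scale_pos _))).symm
  rw [show T.sector i = wedge (T.v i) (T.v (i + 1)) (T.v (i + 2)) from rfl, hunit,
    ← wedge_smul one_ne_zero hb hc, one_smul]

theorem mink_horocycle_chord_self (h : IsLabelling i j k) (hi : T.type i = 0) :
    mink ((2 * T.gram j)⁻¹ • T.unit k - (2 * T.gram k)⁻¹ • T.unit j)
      ((2 * T.gram j)⁻¹ • T.unit k - (2 * T.gram k)⁻¹ • T.unit j) =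
        (T.volume / (2 * T.gram j * T.gram k)) ^ 2 := by
  have hj := T.gram_pos j
  have hk := T.gram_pos k
  rw [div_pow, T.volume_sq h, hi]
  simp only [mink_sub_left, mink_sub_right, mink_smul_left, mink_smul_right, mink_unit_self,
    T.mink_unit_unit h, T.mink_unit_unit h.swap]
  field_simp
  ring

theorem angle_of_type_eq_zero (h : IsLabelling i j k) (hi : T.type i = 0) :
    T.angle i = T.volume / (T.gram j * T.gram k) := by
  wlog hs : j = i + 1 ∧ k = i + 2 generalizing j k
  · rw [mul_comm (T.gram j)]
    exact this h.swap (h.eq_succ_or_swap.resolve_left hs).symm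
  have hj := T.gram_pos j
  have hk := T.gram_pos k
  have hv := T.type_eq_zero_iff.1 hi
  have hself : mink (T.unit i) (T.unit i) = 0 := by rw [mink_unit_self, hi, neg_zero]
  have hhoro : T.bodyBoundary i = {x | x ∈ hypPlane ∧ -mink x (T.unit i) = 1 / 2} := by
    rw [bodyBoundary_eq_unitBodyBoundary, unitBodyBoundary, hself, sub_zero]
  have hu : mink ((2 * T.gram k)⁻¹ • T.unit j) (T.unit i) = -1 / 2 := by
    rw [mink_smul_left, T.mink_unit_unit h.rotate.rotate.swap]
    field_simp
  have hw : mink ((2 * T.gram j)⁻¹ • T.unit k) (T.unit i) = -1 / 2 := by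
    rw [mink_smul_left, T.mink_unit_unit h.rotate]
    field_simp
  have hchord := T.mink_horocycle_chord_self h hi
  have hpos : 0 < T.volume / (2 * T.gram j * T.gram k) := div_pos T.volume_pos (by positivity)
  rw [angle, if_neg hv.not_lt, if_pos hv, hhoro,
    T.sector_eq_wedge i (b := (2 * T.gram k)⁻¹) (c := (2 * T.gram j)⁻¹) (by positivity)
      (by positivity), ← hs.1, ← hs.2, horocycle_inter_wedge hself (T.unit_time_pos hv.le) hu hw,
    arcLength_horocyclePoint_segment hself hu hw (by rw [hchord]; positivity), hchord,
    Real.sqrt_sq hpos.le]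
  field_simp

end GenTriangle

/-! ### Trigonometry of generalized angles -/

section Rho

variable {e : ℝ}

theorem rho'_sq_add_mul_rho_sq (he : e = 1 ∨ e = 0 ∨ e = -1) (θ : ℝ) :
    rho' e θ ^ 2 + e * rho e θ ^ 2 = 1 := by
  rcases he with rfl | rfl | rfl
  · rw [rho'_one, rho_one, one_mul, Real.cos_sq_add_sin_sq]
  · rw [rho'_zero, one_pow, zero_mul, add_zero]
  · rw [rho'_neg_one, rho_neg_one, neg_one_mul, ← sub_eq_add_neg, Real.cosh_sq_sub_sinh_sq]

theorem rho'_eq_one_sub_mul_rho_half_sq (he : e = 1 ∨ e = 0 ∨ e = -1) (θ : ℝ) :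
    rho' e θ = 1 - e * (2 * rho e (θ / 2) ^ 2) := by
  rcases he with rfl | rfl | rfl
  · rw [rho'_one, rho_one, one_mul, Real.sin_sq_eq_half_sub, mul_div_cancel₀ θ two_ne_zero]
    ring
  · rw [rho'_zero, zero_mul, sub_zero]
  · have hdouble := Real.cosh_two_mul (θ / 2)
    rw [mul_div_cancel₀ θ two_ne_zero] at hdouble
    rw [rho'_neg_one, rho_neg_one, hdouble, Real.cosh_sq]
    ring

end Rho

namespace GenTriangle

variable (T : GenTriangle) {i j k : Fin 3}

theorem minor_mul_minor_sq (h : IsLabelling i j k) :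
    (T.minor j * T.minor k) ^ 2 =
      (T.gram j * T.gram k - T.type i * T.gram i) ^ 2 + T.type i * T.volume ^ 2 := by
  rw [mul_pow, T.minor_sq h.rotate, T.minor_sq h.rotate.rotate, T.volume_sq h]
  ring

theorem minor_eq_gram (h : IsLabelling i j k) (hj : T.type j = 0) : T.minor i = T.gram i := by
  rw [T.minor_eq_sqrt h, hj, zero_mul, sub_zero, Real.sqrt_sq (T.gram_pos i).le]

theorem rho'_angle (h : IsLabelling i j k) :
    rho' (T.type i) (T.angle i) =
      (T.gram j * T.gram k - T.type i * T.gram i) / (T.minor j * T.minor k) := by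
  have hm : 0 < T.minor j * T.minor k := mul_pos (T.minor_pos j) (T.minor_pos k)
  rcases T.type_cases i with hi | hi | hi
  · have hsq := T.minor_mul_minor_sq h
    rw [hi, one_mul, one_mul] at hsq
    have habs : |T.gram j * T.gram k - T.gram i| ≤ T.minor j * T.minor k :=
      abs_le_of_sq_le_sq (by linarith [sq_nonneg T.volume]) hm.le
    rw [hi, rho'_one, T.angle_of_type_eq_one h hi, one_mul, Real.cos_arccos]
    · rw [le_div_iff₀ hm, neg_one_mul]
      exact (abs_le.1 habs).1
    · exact (div_le_one hm).2 (abs_le.1 habs).2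
  · rw [hi, rho'_zero, zero_mul, sub_zero, T.minor_eq_gram h.rotate.swap hi,
      T.minor_eq_gram h.rotate.rotate hi, div_self]
    exact (mul_pos (T.gram_pos j) (T.gram_pos k)).ne'
  · rw [hi, rho'_neg_one, (T.angle_of_type_eq_neg_one h hi).2, neg_one_mul, sub_neg_eq_add]

theorem rho_angle_nonneg (i : Fin 3) : 0 ≤ rho (T.type i) (T.angle i) := by
  have h := IsLabelling.succ i
  rcases T.type_cases i with hi | hi | hi
  · rw [hi, rho_one, T.angle_of_type_eq_one h hi, Real.sin_arccos]
    exact Real.sqrt_nonneg _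
  · rw [hi, rho_zero, T.angle_of_type_eq_zero h hi]
    exact (div_pos T.volume_pos (mul_pos (T.gram_pos _) (T.gram_pos _))).le
  · rw [hi, rho_neg_one, Real.sinh_nonneg_iff]
    exact (T.angle_of_type_eq_neg_one h hi).1

theorem rho_angle (h : IsLabelling i j k) :
    rho (T.type i) (T.angle i) = T.volume / (T.minor j * T.minor k) := by
  have hm : 0 < T.minor j * T.minor k := mul_pos (T.minor_pos j) (T.minor_pos k)
  by_cases hi : T.type i = 0
  · rw [hi, rho_zero, T.angle_of_type_eq_zero h hi, T.minor_eq_gram h.rotate.swap hi,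
      T.minor_eq_gram h.rotate.rotate hi]
  have hsq : rho (T.type i) (T.angle i) ^ 2 = (T.volume / (T.minor j * T.minor k)) ^ 2 := by
    have hpyth := rho'_sq_add_mul_rho_sq (T.type_cases i) (T.angle i)
    have hminor := T.minor_mul_minor_sq h
    rw [T.rho'_angle h, div_pow, div_add' _ _ _ (pow_pos hm 2).ne',
      div_eq_one_iff_eq (pow_pos hm 2).ne'] at hpyth
    rw [div_pow, eq_div_iff (pow_pos hm 2).ne']
    exact mul_left_cancel₀ hi (by linarith)
  exact (pow_left_inj₀ (T.rho_angle_nonneg i) (div_pos T.volume_pos hm).le two_ne_zero).1 hsq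

theorem rho_half_angle (h : IsLabelling i j k) :
    2 * rho (T.type i) (T.angle i / 2) ^ 2 =
      (T.gram i - 1 / 2 * T.type j * Real.exp (T.length j - T.length k) -
        1 / 2 * T.type k * Real.exp (T.length k - T.length j)) / (T.minor j * T.minor k) := by
  have hj := T.minor_pos j
  have hk := T.minor_pos k
  by_cases hi : T.type i = 0
  · have hj' := T.gram_pos j
    have hk' := T.gram_pos k
    have hvol := T.volume_sq h
    rw [hi, rho_zero, T.angle_of_type_eq_zero h hi, Real.exp_sub, Real.exp_sub, exp_length,
      exp_length, T.minor_eq_gram h.rotate.swap hi, T.minor_eq_gram h.rotate.rotate hi]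
    rw [hi] at hvol
    field_simp
    linear_combination hvol
  refine mul_left_cancel₀ hi ?_
  have hcos := (rho'_eq_one_sub_mul_rho_half_sq (T.type_cases i) (T.angle i)).symm.trans
    (T.rho'_angle h)
  have hexpj := T.type_mul_type_mul_exp_neg_length h.rotate
  have hexpk := T.type_mul_type_mul_exp_neg_length h.rotate.rotate
  have hnum : T.type i * (T.gram i - 1 / 2 * T.type j * Real.exp (T.length j - T.length k) -
      1 / 2 * T.type k * Real.exp (T.length k - T.length j)) =
        T.minor j * T.minor k - (T.gram j * T.gram k - T.type i * T.gram i) := by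
    rw [sub_eq_add_neg (T.length j), sub_eq_add_neg (T.length k), Real.exp_add, Real.exp_add,
      exp_length, exp_length]
    linear_combination -(1 / 2) * (T.gram j + T.minor j) * hexpk -
      (1 / 2) * (T.gram k + T.minor k) * hexpj
  rw [← mul_div_assoc, hnum, sub_div, div_self (mul_pos hj hk).ne', ← hcos, sub_sub_cancel]

theorem gram_cofactor_identity (h : IsLabelling i j k) :
    (T.gram j * T.gram k - T.type i * T.gram i) * T.minor i ^ 2 +
      (T.gram k * T.gram i - T.type j * T.gram j) * (T.gram i * T.gram j - T.type k * T.gram k) =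
        T.gram i * T.volume ^ 2 := by
  rw [T.minor_sq h, T.volume_sq h]
  ring

theorem gram_eq_rho'_add_div (h : IsLabelling i j k) :
    T.gram i =
      (rho' (T.type i) (T.angle i) +
          rho' (T.type j) (T.angle j) * rho' (T.type k) (T.angle k)) /
        (rho (T.type j) (T.angle j) * rho (T.type k) (T.angle k)) := by
  have hi := T.minor_pos i
  have hj := T.minor_pos j
  have hk := T.minor_pos k
  have hvol := T.volume_pos
  rw [T.rho'_angle h, T.rho'_angle h.rotate, T.rho'_angle h.rotate.rotate,
    T.rho_angle h.rotate, T.rho_angle h.rotate.rotate]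
  field_simp
  linear_combination -T.gram_cofactor_identity h

end GenTriangle

end

theorem mainTheorem4 (T : GenTriangle) (ε θ l : Fin 3 → ℝ)
    (hε : ∀ i, ε i = T.type i) (hθ : ∀ i, θ i = T.angle i) (hl : ∀ i, l i = T.length i) :
    (∀ i : Fin 3, rho (ε i) (θ i) ≠ 0) ∧
    ∀ i j k : Fin 3, i ≠ j → j ≠ k → k ≠ i →
      tau (ε j * ε k) (l i) ≠ 0 ∧
      tau' (ε j * ε k) (l i) =
        (rho' (ε i) (θ i) + rho' (ε j) (θ j) * rho' (ε k) (θ k)) /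
          (rho (ε j) (θ j) * rho (ε k) (θ k)) ∧
      2 * rho (ε i) (θ i / 2) ^ 2 =
        (tau' (ε j * ε k) (l i) - 1 / 2 * ε j * Real.exp (l j - l k)
            - 1 / 2 * ε k * Real.exp (l k - l j)) /
          (tau (ε k * ε i) (l j) * tau (ε i * ε j) (l k)) ∧
      rho' (ε i) (θ i) =
        (-(ε i) * tau' (ε j * ε k) (l i) + tau' (ε k * ε i) (l j) * tau' (ε i * ε j) (l k)) /
          (tau (ε k * ε i) (l j) * tau (ε i * ε j) (l k)) ∧
      rho (ε i) (θ i) / tau (ε j * ε k) (l i) = rho (ε j) (θ j) / tau (ε k * ε i) (l j) := by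
  obtain rfl : ε = T.type := funext hε
  obtain rfl : θ = T.angle := funext hθ
  obtain rfl : l = T.length := funext hl
  have hminor (i : Fin 3) := (T.minor_pos i).ne'
  refine ⟨fun i => ?_, fun i j k hij hjk hki => ?_⟩
  · rw [T.rho_angle (.succ i)]
    exact div_ne_zero T.volume_pos.ne' (mul_ne_zero (hminor _) (hminor _))
  have h : IsLabelling i j k := ⟨hij, hjk, hki⟩
  rw [T.tau_length h, T.tau_length h.rotate, T.tau_length h.rotate.rotate, T.tau'_length h,
    T.tau'_length h.rotate, T.tau'_length h.rotate.rotate]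
  refine ⟨hminor i, T.gram_eq_rho'_add_div h, T.rho_half_angle h, ?_, ?_⟩
  · rw [T.rho'_angle h, neg_mul, neg_add_eq_sub]
  · rw [T.rho_angle h, T.rho_angle h.rotate, div_div, div_div]
    ring_nf
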